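/- Let $d\ge 2$ and $L>0$. For $x\in\mathbb R^d$ and a unit vector $p$ let $S_{x,p,L}$ be the stick of length $L$ and radius $1$ with centre $x$ and orientation $p$, that is, the set of all points of $\mathbb R^d$ at Euclidean distance at most $1$ from the segment $\{x+tp: -L/2\le t\le L/2\}$. For $\lambda>0$ let $\Pi^\lambda$ be a Poisson point process on $\mathbb R^d\times\mathbb S^{d-1}$ with intensity measure $\lambda\,\mathrm{Leb}\otimes\delta_{e_2}$, where $e_2$ is the second standard unit vector (the rigid case: all sticks are oriented along $e_2$). Let $\mathcal C(\Pi^\lambda)=\bigcup_{(x,p)\in\Pi^\lambda}S_{x,p,L}$, say that percolation occurs if $\mathcal C(\Pi^\lambda)$ has an unbounded connected component, and put $$\lambda_{c,r}(L)=\inf\{\lambda>0:\ \mathbb P(\mathcal C(\Pi^\lambda)\text{ percolates})=1\}.$$ Then, for every $d\ge 2$ and every $L>3$, $$\lambda_{c,r}(L)\ \ge\ \frac{\Gamma((d+1)/2)}{2^d\,\pi^{d/2}}\,L^{-1},$$ and, for every $d\ge 2$ and every $L>10$, $$\lambda_{c,r}(L)\ \le\ 4\,\frac{2^d\,\Gamma((d+1)/2)}{\pi^{d/2-1}}\,L^{-1}.$$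 -/

import Mathlib

open MeasureTheory ProbabilityTheory Set
open scoped ENNReal

noncomputable section

namespace PoissonStick

/-- The unit sphere of `ℝ^d`, i.e. the set of possible orientations of a stick. -/
abbrev Orientation (d : ℕ) : Type := Metric.sphere (0 : EuclideanSpace ℝ (Fin d)) 1

/-- The line segment of length `L` centred at `x` with orientation `p`. -/
def segment {d : ℕ} (L : ℝ) (x : EuclideanSpace ℝ (Fin d)) (p : Orientation d) :
    Set (EuclideanSpace ℝ (Fin d)) :=
  {y | ∃ t : ℝ, -L / 2 ≤ t ∧ t ≤ L / 2 ∧ y = x + t • (p : EuclideanSpace ℝ (Fin d))}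

/-- The stick of length `L` and radius `1`: all points at distance at most `1` from the segment. -/
def stick {d : ℕ} (L : ℝ) (x : EuclideanSpace ℝ (Fin d)) (p : Orientation d) :
    Set (EuclideanSpace ℝ (Fin d)) :=
  {y | Metric.infDist y (segment L x p) ≤ 1}

/-- Locally finite configurations of (centre, orientation) pairs. -/
def Config (d : ℕ) : Type :=
  {ω : Set (EuclideanSpace ℝ (Fin d) × Orientation d) //
    ∀ A : Set (EuclideanSpace ℝ (Fin d)), Bornology.IsBounded A → (ω ∩ A ×ˢ univ).Finite}

/-- The number of points of the configuration `ω` in `B`. -/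
def count {d : ℕ} (B : Set (EuclideanSpace ℝ (Fin d) × Orientation d)) (ω : Config d) : ℕ∞ :=
  (ω.1 ∩ B).encard

/-- The σ-algebra on configurations generated by the counts in measurable sets. -/
instance instMeasurableSpaceConfig (d : ℕ) : MeasurableSpace (Config d) :=
  ⨆ (B : Set (EuclideanSpace ℝ (Fin d) × Orientation d)) (_ : MeasurableSet B),
    MeasurableSpace.comap (count B) inferInstance

/-- `N` is a (simple) Poisson point process with intensity measure `μ`, defined on the
probability space `(Ω, P)`: the number of points in a measurable set of finite `μ`-measure is
Poisson distributed with parameter the measure of that set, and the numbers of points in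
pairwise disjoint measurable sets are independent. -/
structure IsPoissonPointProcess {d : ℕ} {Ω : Type} [MeasurableSpace Ω]
    (μ : Measure (EuclideanSpace ℝ (Fin d) × Orientation d))
    (N : Ω → Config d) (P : Measure Ω) : Prop where
  measurable : Measurable N
  hasLaw_count : ∀ B, MeasurableSet B → μ B ≠ ∞ →
    HasLaw (fun a => count B (N a)) ((poissonMeasure (μ B).toNNReal).map (fun k : ℕ => (k : ℕ∞))) P
  indep_count : ∀ (n : ℕ) (B : Fin n → Set (EuclideanSpace ℝ (Fin d) × Orientation d)),
    (∀ i, MeasurableSet (B i)) → Pairwise (fun i j => Disjoint (B i) (B j)) →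
    iIndepFun (fun i a => count (B i) (N a)) P

/-- The intensity measure `lam • Leb ⊗ Θ`. -/
def intensity {d : ℕ} (Θ : Measure (Orientation d)) (lam : ℝ) :
    Measure (EuclideanSpace ℝ (Fin d) × Orientation d) :=
  ENNReal.ofReal lam • (volume : Measure (EuclideanSpace ℝ (Fin d))).prod Θ

/-- The occupied set: the union of all sticks of the configuration. -/
def occupied {d : ℕ} (L : ℝ) (ω : Config d) : Set (EuclideanSpace ℝ (Fin d)) :=
  ⋃ q ∈ ω.1, stick L q.1 q.2

/-- The occupied set has an unbounded connected component. -/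
def Percolates {d : ℕ} (L : ℝ) (ω : Config d) : Prop :=
  ∃ x ∈ occupied L ω, ¬ Bornology.IsBounded (connectedComponentIn (occupied L ω) x)

/-- The Poisson stick model with intensity `lam`, stick length `L` and orientation distribution
`Θ` percolates almost surely. (The law of a Poisson point process is determined by its intensity
measure, so that it does not matter which realization is used.) -/
def PercolatesAlmostSurely {d : ℕ} (Θ : Measure (Orientation d)) (L lam : ℝ) : Prop :=
  ∃ (Ω : Type) (_ : MeasurableSpace Ω) (P : Measure Ω) (N : Ω → Config d),
    IsProbabilityMeasure P ∧ IsPoissonPointProcess (intensity Θ lam) N P ∧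
      ∀ᵐ a ∂P, Percolates L (N a)

/-- The critical intensity of the model with orientation distribution `Θ`. The infimum is taken
in the extended reals, where the infimum of the empty set is `+∞`. -/
def criticalIntensity {d : ℕ} (Θ : Measure (Orientation d)) (L : ℝ) : EReal :=
  sInf {z : EReal | ∃ lam : ℝ, 0 < lam ∧ PercolatesAlmostSurely Θ L lam ∧ z = (lam : EReal)}

/-- The second standard unit vector, as an orientation (coordinates are numbered from `0`). -/
def e₂ {d : ℕ} (hd : 2 ≤ d) : Orientation d :=
  ⟨EuclideanSpace.single (⟨1, hd⟩ : Fin d) (1 : ℝ), by simp⟩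

/-- The critical intensity in the rigid case, where all sticks are oriented along `e₂`. -/
def rigidCriticalIntensity {d : ℕ} (hd : 2 ≤ d) (L : ℝ) : EReal :=
  criticalIntensity (Measure.dirac (e₂ hd)) L

end PoissonStick

end

/-! Two parallel sticks meet only if the difference of their centres lies in a cylinder with
half-height `L + 2` along the axis and radius 2 across it, and they do meet as soon as it lies in
the cylinder with half-height `L` and the same radius. Both bounds follow from comparing the process
of centres with a planar or `d`-dimensional lattice model. Throughout, `d = n + 1`, and `n` is the
dimension transverse to the sticks.

Lower bound. Cut space into cubes of small side `ε`. An infinite cluster forces arbitrarily long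
self-avoiding paths of occupied cubes whose steps lie in the finite set `neighbours`. Occupation of
distinct cubes is independent, of probability at most `lam * ε ^ d`, so the expected number of such
paths decays geometrically once `lam` times the volume of the larger cylinder is below 1 and `ε` is
small (`measure_hasPath_le`, `card_mul_le_of_subset_neighbours`). Then every cluster of cubes is
finite and the occupied set has no unbounded component (`not_percolates_of_finite_clusters`).

Upper bound. A planar array of cells, of length `L / 2` and radius `1 / 2`, is chosen so that sticks
centred in the same or in adjacent cells always meet. Cells are empty independently with small
probability. Instead of a contour count, a 3-adic renormalisation is used: a block is bad if two of
its nine subblocks are bad, so badness probabilities satisfy `q' ≤ 72 q²` and are summable over the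
levels (`measure_forall_bad_le`). The sticks collected through the good subblocks of a good block
form a connected set (`blockUnion_connected`), and the blocks at the origin are eventually good by
Borel–Cantelli.

Almost sure percolation is defined through the existence of a realization, so the upper bound also
requires constructing a Poisson process. In each annulus, a Poisson number of independent uniform
points is drawn (`exists_rigid_process`); the Poisson law and the independence of the counts are
read off from characteristic functions. -/

namespace PoissonStick

/-! ### Counts of a Poisson number of independent points -/

section Thinning

variable {E : Type*}

open scoped Classical in
/-- The number of indices `i < k` with `x i ∈ B`. -/
noncomputable def hits (B : Set E) (ω : ℕ × (ℕ → E)) : ℕ :=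
  ((Finset.range ω.1).filter fun i => ω.2 i ∈ B).card

lemma hits_cast (B : Set E) (ω : ℕ × (ℕ → E)) :
    (hits B ω : ℝ) = ∑ i ∈ Finset.range ω.1, B.indicator (fun _ => (1 : ℝ)) (ω.2 i) := by
  classical
  simp only [hits, Finset.card_filter, Set.indicator_apply, Nat.cast_sum, Nat.cast_ite,
    Nat.cast_one, Nat.cast_zero]

variable [MeasurableSpace E]

open Complex in
/-- The characteristic function of a compound Poisson variable. -/
lemma integral_exp_compound_poisson (r : NNReal) (ν : Measure E) [IsProbabilityMeasure ν]
    (f : E → ℝ) (hf : Measurable f) :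
    ∫ ω, cexp ((∑ i ∈ Finset.range ω.1, f (ω.2 i) : ℝ) * I)
        ∂((poissonMeasure r).prod (Measure.infinitePi fun _ : ℕ => ν))
      = cexp (r * ((∫ x, cexp (f x * I) ∂ν) - 1)) := by
  have hm : Measurable fun ω : ℕ × (ℕ → E) => (∑ i ∈ Finset.range ω.1, f (ω.2 i) : ℝ) :=
    measurable_from_prod_countable_right fun k => by
      simp only
      fun_prop
  rw [integral_prod]
  · have hin : ∀ k : ℕ, ∫ x : ℕ → E, cexp ((∑ i ∈ Finset.range k, f (x i) : ℝ) * I)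
        ∂(Measure.infinitePi fun _ : ℕ => ν) = (∫ x, cexp (f x * I) ∂ν) ^ k := by
      intro k
      have hind : iIndepFun (fun (i : ℕ) (x : ℕ → E) => f (x i))
          (Measure.infinitePi fun _ : ℕ => ν) :=
        iIndepFun_infinitePi (X := fun _ => f) (fun _ => hf)
      have := congrFun (iIndepFun.charFun_map_fun_finsetSum_eq_prod (s := Finset.range k)
        (X := fun (i : ℕ) (x : ℕ → E) => f (x i))
        (fun i _ => (hf.comp (measurable_pi_apply i)).aemeasurable)
        (hind.restrict _)) 1
      have hm1 : ∀ i, Measurable fun x : ℕ → E => f (x i) :=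
        fun i => hf.comp (measurable_pi_apply i)
      rw [charFun_apply, integral_map
        (Finset.measurable_sum _ fun i _ => hm1 i).aemeasurable (by fun_prop)] at this
      simp only [Real.inner_apply, mul_one] at this
      rw [this, Finset.prod_apply, ← Finset.card_range k, ← Finset.prod_const, Finset.card_range]
      refine Finset.prod_congr rfl fun i _ => ?_
      rw [charFun_apply, integral_map (hm1 i).aemeasurable (by fun_prop)]
      have h2 := (measurePreserving_eval_infinitePi (fun _ : ℕ => ν) i)
      simp only [Real.inner_apply, mul_one]
      exact h2.hasLaw.integral_comp (f := fun x => cexp (f x * I)) (by fun_prop)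
    simp only [hin]
    rw [integral_poissonMeasure]
    set φ := ∫ x, cexp (f x * I) ∂ν
    calc ∑' n : ℕ, (Real.exp (-r) * r ^ n / (n.factorial)) • φ ^ n
        = ∑' n : ℕ, (Real.exp (-r) : ℂ) * ((r * φ) ^ n / n.factorial) := by
          congr with n
          rw [Complex.real_smul]
          push_cast
          rw [mul_pow]
          ring
      _ = _ := by
          rw [tsum_mul_left, (NormedSpace.expSeries_div_hasSum_exp ((r : ℂ) * φ)).tsum_eq,
            ← Complex.exp_eq_exp_ℂ, ofReal_exp, ← Complex.exp_add]
          push_cast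
          ring_nf
  · refine Integrable.of_bound (C := 1)
      (Complex.measurable_exp.comp ((Complex.measurable_ofReal.comp hm).mul_const _)
        ).aestronglyMeasurable (.of_forall fun ω => ?_)
    rw [Complex.norm_exp_ofReal_mul_I]

lemma measurable_hits {B : Set E} (hB : MeasurableSet B) : Measurable (hits B) := by
  classical
  refine measurable_from_prod_countable_right fun k => ?_
  simp only [hits, Finset.card_filter]
  refine Finset.measurable_sum _ fun i _ => ?_
  exact Measurable.ite (hB.preimage (measurable_pi_apply i)) measurable_const measurable_const

-- This is the compound Poisson formula for the function equal to `t j` on `B j`. Disjointness lets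
-- at most one indicator contribute at each point, so `exp (i f) - 1` is the sum of the `exp (i t j)
-- - 1` over the sets, and the exponent splits. The product form yields both the Poisson law of each
-- count and their joint independence.
open Complex in
lemma integral_exp_hits (r : NNReal) (ν : Measure E) [IsProbabilityMeasure ν] {ι : Type*}
    [Fintype ι] (B : ι → Set E) (hB : ∀ j, MeasurableSet (B j))
    (hd : Pairwise fun i j => Disjoint (B i) (B j)) (t : ι → ℝ) :
    ∫ ω, cexp ((∑ j, (hits (B j) ω : ℝ) * t j : ℝ) * I)
        ∂((poissonMeasure r).prod (Measure.infinitePi fun _ : ℕ => ν))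
      = ∏ j, cexp (r * ν.real (B j) * (cexp (t j * I) - 1)) := by
  have h := integral_exp_compound_poisson r ν
    (fun x => ∑ j, (B j).indicator (fun _ => (1 : ℝ)) x * t j)
    (Finset.measurable_sum _ fun j _ => (measurable_const.indicator (hB j)).mul_const _)
  have e1 : ∀ ω : ℕ × (ℕ → E), ∑ i ∈ Finset.range ω.1,
      ∑ j, (B j).indicator (fun _ => (1 : ℝ)) (ω.2 i) * t j = ∑ j, (hits (B j) ω : ℝ) * t j := by
    intro ω
    rw [Finset.sum_comm]
    simp_rw [hits_cast, Finset.sum_mul]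
  simp only [e1] at h
  rw [h, ← Complex.exp_sum]
  congr 1
  have e2 : ∀ x, cexp ((∑ j, (B j).indicator (fun _ => (1 : ℝ)) x * t j : ℝ) * I)
      = 1 + ∑ j, (B j).indicator (fun _ => cexp (t j * I) - 1) x := by
    intro x
    by_cases hx : ∃ j, x ∈ B j
    · obtain ⟨j, hj⟩ := hx
      have hne : ∀ i, i ≠ j → x ∉ B i := fun i hi hxi => (hd hi).le_bot ⟨hxi, hj⟩
      rw [Finset.sum_eq_single j, Finset.sum_eq_single j]
      · simp [hj]
      · intro i _ hi; simp [hne i hi]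
      · simp
      · intro i _ hi; simp [hne i hi]
      · simp
    · push Not at hx
      simp [hx]
  simp only [e2]
  rw [integral_add (by simp) (integrable_finsetSum _ fun j _ =>
    (integrable_const _).indicator (hB j)), integral_finsetSum _ fun j _ =>
    (integrable_const _).indicator (hB j)]
  simp only [integral_indicator_const _ (hB _), integral_const, probReal_univ, one_smul,
    add_sub_cancel_left, Finset.mul_sum, Complex.real_smul]
  exact Finset.sum_congr rfl fun j _ => by ring

lemma hasLaw_hits (r : NNReal) (ν : Measure E) [IsProbabilityMeasure ν] {B : Set E}
    (hB : MeasurableSet B) :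
    HasLaw (hits B) (poissonMeasure (r * (ν B).toNNReal))
      ((poissonMeasure r).prod (Measure.infinitePi fun _ : ℕ => ν)) := by
  have hm := measurable_hits hB
  refine ⟨hm.aemeasurable, ?_⟩
  apply (MeasurableEmbedding.natCast (α := ℝ)).map_injective
  have hmc : Measurable (fun n : ℕ => (n : ℝ)) := measurable_from_top
  have : IsProbabilityMeasure (Measure.map Nat.cast (Measure.map (hits B)
      ((poissonMeasure r).prod (Measure.infinitePi fun _ : ℕ => ν))) : Measure ℝ) := by
    have := Measure.isProbabilityMeasure_map (μ := ((poissonMeasure r).prod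
      (Measure.infinitePi fun _ : ℕ => ν))) hm.aemeasurable
    exact Measure.isProbabilityMeasure_map hmc.aemeasurable
  apply Measure.ext_of_charFun
  ext t
  rw [charFun_map_cast_poissonMeasure, Measure.map_map hmc hm, charFun_apply,
    integral_map (hmc.comp hm).aemeasurable (by fun_prop)]
  have h := integral_exp_hits r ν (fun _ : Unit => B) (fun _ => hB) (fun i j hij => by
    exact absurd (Subsingleton.elim i j) hij) (fun _ => t)
  simp only [Finset.univ_unique, Finset.sum_singleton, Finset.prod_singleton] at h
  simp only [Real.inner_apply, Function.comp]
  rw [h]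
  push_cast
  rfl

lemma iIndepFun_hits (r : NNReal) (ν : Measure E) [IsProbabilityMeasure ν] {ι : Type*}
    [Fintype ι] (B : ι → Set E) (hB : ∀ j, MeasurableSet (B j))
    (hd : Pairwise fun i j => Disjoint (B i) (B j)) :
    iIndepFun (fun j => hits (B j))
      ((poissonMeasure r).prod (Measure.infinitePi fun _ : ℕ => ν)) := by
  have hmc : Measurable (fun n : ℕ => (n : ℝ)) := measurable_from_top
  have key : iIndepFun (fun j ω => (hits (B j) ω : ℝ))
      ((poissonMeasure r).prod (Measure.infinitePi fun _ : ℕ => ν)) := by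
    have hm : ∀ j, Measurable fun ω => (hits (B j) ω : ℝ) :=
      fun j => hmc.comp (measurable_hits (hB j))
    rw [iIndepFun_iff_charFun_pi fun j => (hm j).aemeasurable]
    intro t
    have e : ∀ j, Measure.map (fun ω => (hits (B j) ω : ℝ)) ((poissonMeasure r).prod
        (Measure.infinitePi fun _ : ℕ => ν)) = Measure.map Nat.cast
          (poissonMeasure (r * (ν (B j)).toNNReal)) := by
      intro j
      rw [← (hasLaw_hits r ν (hB j)).map_eq, Measure.map_map hmc (measurable_hits (hB j))]
      rfl
    simp only [e, charFun_map_cast_poissonMeasure]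
    have hL : Measurable fun ω => WithLp.toLp 2 fun j => (hits (B j) ω : ℝ) :=
      (WithLp.measurable_toLp 2 _).comp (measurable_pi_lambda _ hm)
    rw [charFun_apply, integral_map hL.aemeasurable (by fun_prop)]
    have h := integral_exp_hits r ν B hB hd (fun j => t j)
    simp only [PiLp.inner_apply, Real.inner_apply]
    rw [h]
    push_cast
    rfl
  -- The floor recovers the integer counts from their real casts, on which the characteristic
  -- functions live.
  have := key.comp (fun _ (x : ℝ) => ⌊x⌋₊) (fun _ => Nat.measurable_floor)
  refine this.congr fun j => .of_forall fun ω => ?_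
  simp

end Thinning

/-! ### Countable sums of independent Poisson variables -/

section InfiniteSum

lemma measurable_enat_of_le {α : Type*} [MeasurableSpace α] {f : α → ℕ∞}
    (h : ∀ k : ℕ, MeasurableSet {a | f a ≤ k}) : Measurable f := by
  refine measurable_to_countable' fun x => ?_
  induction x using ENat.recTopCoe with
  | top =>
    have : f ⁻¹' {⊤} = (⋃ k : ℕ, {a | f a ≤ k})ᶜ := by
      ext a
      simp only [mem_preimage, mem_singleton_iff, mem_compl_iff, mem_iUnion, mem_ofPred_eq,
        not_exists, not_le]
      constructor
      · intro ha k; rw [ha]; exact ENat.natCast_lt_top k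
      · intro ha
        by_contra hne
        obtain ⟨n, hn⟩ := ENat.ne_top_iff_exists.1 hne
        exact absurd (ha n) (by rw [hn]; exact lt_irrefl _)
    rw [this]
    exact (MeasurableSet.iUnion h).compl
  | coe n =>
    cases n with
    | zero =>
      convert h 0 using 1
      ext a; simp
    | succ n =>
      convert (h (n + 1)).diff (h n) using 1
      ext a
      simp only [mem_preimage, mem_singleton_iff, mem_sdiff, mem_ofPred_eq, not_le]
      constructor
      · rintro h; rw [h]; exact ⟨le_rfl, by exact_mod_cast Nat.lt_succ_self n⟩
      · rintro ⟨h1, h2⟩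
        refine le_antisymm h1 ?_
        push_cast
        exact Order.add_one_le_of_lt h2

/-- The finite initial segments form a π-system generating the full σ-algebra of `ℕ∞`; the point `⊤`
is the complement of their union. -/
lemma ext_enat_of_Iic {μ ν : Measure ℕ∞} [IsProbabilityMeasure μ] [IsProbabilityMeasure ν]
    (h : ∀ k : ℕ, μ (Iic (k : ℕ∞)) = ν (Iic (k : ℕ∞))) : μ = ν := by
  have hT : (inferInstance : MeasurableSpace ℕ∞) =
      MeasurableSpace.generateFrom (range fun k : ℕ => Iic (k : ℕ∞)) := by
    refine le_antisymm ?_ fun _ _ => trivial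
    have : @Measurable ℕ∞ ℕ∞ (MeasurableSpace.generateFrom (range fun k : ℕ => Iic (k : ℕ∞)))
        _ id := by
      refine @measurable_enat_of_le ℕ∞ (_) _ fun k => ?_
      exact MeasurableSpace.measurableSet_generateFrom ⟨k, rfl⟩
    exact fun s hs => this hs
  refine ext_of_generate_finite _ hT ?_ ?_ (by simp)
  · rintro _ ⟨i, rfl⟩ _ ⟨j, rfl⟩ _
    refine ⟨min i j, ?_⟩
    ext x
    simp only [mem_inter_iff, mem_Iic]
    rw [← le_min_iff]
    rcases le_total i j with h | h <;> simp [h]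
  · rintro _ ⟨k, rfl⟩
    exact h k

/-- The sum of a sequence of natural numbers, in the extended natural numbers. -/
noncomputable def natSum (y : ℕ → ℕ) : ℕ∞ := ⨆ m, ((∑ n ∈ Finset.range m, y n : ℕ) : ℕ∞)

lemma natSum_le_iff {y : ℕ → ℕ} {k : ℕ} :
    natSum y ≤ k ↔ ∀ m, ∑ n ∈ Finset.range m, y n ≤ k := by
  simp only [natSum, iSup_le_iff, Nat.cast_le]

lemma measurable_natSum : Measurable natSum := by
  refine measurable_enat_of_le fun k => ?_
  simp only [natSum_le_iff, ofPred_forall]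
  refine MeasurableSet.iInter fun m => ?_
  have : Measurable fun y : ℕ → ℕ => ∑ n ∈ Finset.range m, y n := by fun_prop
  exact measurableSet_le this measurable_const

lemma hasLaw_sum_range {Ω : Type*} [MeasurableSpace Ω] {P : Measure Ω} [IsProbabilityMeasure P]
    {Y : ℕ → Ω → ℕ} {r : ℕ → NNReal} (hm : ∀ n, Measurable (Y n)) (hi : iIndepFun Y P)
    (hl : ∀ n, HasLaw (Y n) (poissonMeasure (r n)) P) (m : ℕ) :
    HasLaw (∑ n ∈ Finset.range m, Y n) (poissonMeasure (∑ n ∈ Finset.range m, r n)) P := by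
  induction m with
  | zero =>
    simp only [Finset.range_zero, Finset.sum_empty]
    have h0 : poissonMeasure 0 = Measure.dirac 0 := by
      refine Measure.ext_of_singleton fun n => ?_
      rw [poissonMeasure_singleton]
      cases n <;> simp
    rw [h0]
    exact hasLaw_dirac_of_ae_eq (.of_forall fun _ => rfl)
  | succ m ih =>
    rw [Finset.sum_range_succ, Finset.sum_range_succ]
    exact (hi.indepFun_finsetSum_of_notMem hm Finset.notMem_range_self).hasLaw_add_poissonMeasure
      ih (hl m)

lemma poissonMeasure_Iic (r : NNReal) (k : ℕ) :
    poissonMeasure r (Iic k) = ENNReal.ofReal (∑ n ∈ Finset.range (k + 1),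
      Real.exp (-r) * r ^ n / n.factorial) := by
  have : (Iic k : Set ℕ) = ((Finset.range (k + 1) : Finset ℕ) : Set ℕ) := by
    ext x; simp
  rw [this, ← sum_measure_singleton, ENNReal.ofReal_sum_of_nonneg fun _ _ => by positivity]
  simp [poissonMeasure_singleton]

/-- The sum of countably many independent Poisson variables is a Poisson variable. -/
lemma hasLaw_natSum {Ω : Type*} [MeasurableSpace Ω] {P : Measure Ω} [IsProbabilityMeasure P]
    {Y : ℕ → Ω → ℕ} {r : ℕ → NNReal} {s : NNReal} (hm : ∀ n, Measurable (Y n))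
    (hi : iIndepFun Y P) (hl : ∀ n, HasLaw (Y n) (poissonMeasure (r n)) P) (hr : HasSum r s) :
    HasLaw (fun a => natSum fun n => Y n a)
      ((poissonMeasure s).map (fun k : ℕ => (k : ℕ∞))) P := by
  have hmS : Measurable fun a => natSum fun n => Y n a :=
    measurable_natSum.comp (measurable_pi_lambda _ hm)
  refine ⟨hmS.aemeasurable, ?_⟩
  have := Measure.isProbabilityMeasure_map (μ := P) hmS.aemeasurable
  refine ext_enat_of_Iic fun k => ?_
  rw [Measure.map_apply hmS (MeasurableSet.of_discrete),
    Measure.map_apply (measurable_of_countable _) (MeasurableSet.of_discrete)]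
  have e1 : (fun k : ℕ => (k : ℕ∞)) ⁻¹' Iic (k : ℕ∞) = Iic k := by ext; simp
  have e2 : (fun a => natSum fun n => Y n a) ⁻¹' Iic (k : ℕ∞)
      = ⋂ m, (∑ n ∈ Finset.range m, Y n) ⁻¹' Iic k := by
    ext a
    simp [natSum_le_iff]
  rw [e1, e2]
  have hms : ∀ m, Measurable (∑ n ∈ Finset.range m, Y n) := fun m => by
    rw [Finset.sum_fn]
    exact Finset.measurable_sum _ fun n _ => hm n
  -- The events that the first `m` terms sum to at most `k` decrease in `m` to the event for the
  -- whole sum. Their probabilities are Poisson distribution functions, which are continuous in the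
  -- parameter.
  have t1 := tendsto_measure_iInter_atTop (μ := P)
    (s := fun m => (∑ n ∈ Finset.range m, Y n) ⁻¹' Iic k)
    (fun m => ((hms m) MeasurableSet.of_discrete).nullMeasurableSet) (by
      intro m m' hmm a ha
      simp only [mem_preimage, Finset.sum_apply, mem_Iic] at ha ⊢
      exact (Finset.sum_le_sum_of_subset (Finset.range_mono hmm)).trans ha) ⟨0, by simp⟩
  refine tendsto_nhds_unique t1 ?_
  have e3 : ∀ m, P ((∑ n ∈ Finset.range m, Y n) ⁻¹' Iic k)
      = ENNReal.ofReal (∑ n ∈ Finset.range (k + 1),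
      Real.exp (-(∑ n ∈ Finset.range m, r n : NNReal)) * (∑ n ∈ Finset.range m, r n : NNReal) ^ n
        / n.factorial) := by
    intro m
    rw [← poissonMeasure_Iic, ← (hasLaw_sum_range hm hi hl m).map_eq,
      Measure.map_apply (hms m) MeasurableSet.of_discrete]
  rw [poissonMeasure_Iic]
  have hc : Continuous fun R : NNReal => ENNReal.ofReal (∑ n ∈ Finset.range (k + 1),
      Real.exp (-R) * R ^ n / n.factorial) :=
    ENNReal.continuous_ofReal.comp (by fun_prop)
  exact ((hc.tendsto s).comp hr.tendsto_sum_nat).congr fun m => (e3 m).symm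

end InfiniteSum

/-! ### Construction of Poisson processes from annuli -/

section Existence

/-- Grouping an independent family indexed by pairs yields independent random sequences. -/
lemma iIndepFun_group {Ω ι κ 𝓧 : Type*} [MeasurableSpace Ω] [MeasurableSpace 𝓧] {P : Measure Ω}
    [IsProbabilityMeasure P]
    {Y : κ → ι → Ω → 𝓧} (hm : ∀ k i, Measurable (Y k i))
    (h : iIndepFun (fun (p : κ × ι) => Y p.1 p.2) P) :
    iIndepFun (fun i a k => Y k i a) P := by
  have hs : iIndepFun (fun (p : (_ : ι) × κ) => Y p.2 p.1) P :=
    h.precomp (g := fun p : (_ : ι) × κ => (p.2, p.1)) (by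
      rintro ⟨a, b⟩ ⟨a', b'⟩ hab
      simp only [Prod.mk.injEq] at hab
      obtain ⟨rfl, rfl⟩ := hab
      rfl)
  have hp : ∀ i k, IsProbabilityMeasure (P.map (Y k i)) := fun i k =>
    Measure.isProbabilityMeasure_map (hm k i).aemeasurable
  have hj : ∀ i, iIndepFun (fun k => Y k i) P := fun i =>
    h.precomp (g := fun k => (k, i)) (fun a b hab => (Prod.mk.inj hab).1)
  rw [iIndepFun_iff_map_fun_eq_infinitePi_map (by fun_prop)]
  have e1 : ∀ i, P.map (fun a k => Y k i a) = Measure.infinitePi fun k => P.map (Y k i) := fun i =>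
    (iIndepFun_iff_map_fun_eq_infinitePi_map (fun k => hm k i)).1 (hj i)
  simp only [e1]
  rw [← Measure.infinitePi_map_piCurry (fun i k => P.map (Y k i)),
    ← (iIndepFun_iff_map_fun_eq_infinitePi_map (fun p : (_ : ι) × κ => hm p.2 p.1)).1 hs,
    Measure.map_map (by fun_prop) (by fun_prop)]
  rfl

lemma iIndepFun_comp_measurePreserving {Ω Ω' ι 𝓧 : Type*} [MeasurableSpace Ω]
    [MeasurableSpace Ω'] [MeasurableSpace 𝓧] {P : Measure Ω} {Q : Measure Ω'}
    [IsProbabilityMeasure P] {X : ι → Ω' → 𝓧} {g : Ω → Ω'} (hm : ∀ i, Measurable (X i))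
    (hg : MeasurePreserving g P Q) (h : iIndepFun X Q) : iIndepFun (fun i a => X i (g a)) P := by
  have hg' := hg.measurable
  have : IsProbabilityMeasure Q := h.isProbabilityMeasure
  rw [iIndepFun_iff_map_fun_eq_infinitePi_map (by fun_prop)] at h ⊢
  have e : ∀ i, P.map (fun a => X i (g a)) = Q.map (X i) := fun i => by
    rw [← hg.map_eq, Measure.map_map (hm i) hg']
    rfl
  simp only [e]
  rw [← h, ← hg.map_eq, Measure.map_map (by fun_prop) hg']
  rfl

variable {d : ℕ}

/-- The points selected by a sequence of marked sequences: the first `(a n).1` terms of the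
`n`-th sequence, for all `n`. -/
def points {E : Type*} (a : ℕ → ℕ × (ℕ → E)) : Set E :=
  {q | ∃ n i, i < (a n).1 ∧ (a n).2 i = q}

/-- The sequences have distinct terms, the `n`-th one with terms in the `n`-th annulus. -/
def IsSeparated (a : ℕ → ℕ × (ℕ → EuclideanSpace ℝ (Fin d) × Orientation d)) : Prop :=
  (∀ p : ℕ × ℕ, ⌊‖((a p.1).2 p.2).1‖⌋₊ = p.1) ∧
    ∀ p q : ℕ × ℕ, p ≠ q → (a p.1).2 p.2 ≠ (a q.1).2 q.2

/-- Distinctness of the terms makes counting points the same as counting selected indices. A finite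
set of points involves only finitely many sequences, so the partial sums exhaust the cardinality. -/
lemma encard_points_inter
    {a : ℕ → ℕ × (ℕ → EuclideanSpace ℝ (Fin d) × Orientation d)} (ha : IsSeparated a)
    (B : Set (EuclideanSpace ℝ (Fin d) × Orientation d)) :
    (points a ∩ B).encard = natSum fun n => hits B (a n) := by
  classical
  let T : ℕ → Finset ((_ : ℕ) × ℕ) := fun m =>
    (Finset.range m).sigma fun n => (Finset.range (a n).1).filter fun i => (a n).2 i ∈ B
  let g : (_ : ℕ) × ℕ → EuclideanSpace ℝ (Fin d) × Orientation d := fun s => (a s.1).2 s.2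
  have hg : Function.Injective g := by
    rintro ⟨n, i⟩ ⟨m, j⟩ h
    by_contra hne
    exact ha.2 (n, i) (m, j) (fun h' => hne (by
      simp only [Prod.mk.injEq] at h'
      obtain ⟨rfl, rfl⟩ := h'
      rfl)) h
  have hc : ∀ m, ((T m).image g).card = ∑ n ∈ Finset.range m, hits B (a n) := fun m => by
    rw [Finset.card_image_of_injective _ hg, Finset.card_sigma]
    rfl
  refine le_antisymm ?_ (iSup_le fun m => ?_)
  · refine ENat.forall_natCast_le_iff_le.1 fun k hk => ?_
    obtain ⟨t, hts, htk⟩ := Set.exists_subset_encard_eq hk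
    have htf : t.Finite := Set.finite_of_encard_eq_coe htk
    have : ∃ m, t ⊆ ((T m).image g : Finset _) := by
      have hex : ∀ q ∈ t, ∃ s : (_ : ℕ) × ℕ, s.2 < (a s.1).1 ∧ g s = q := by
        intro q hq
        obtain ⟨n, i, h1, h2⟩ := (hts hq).1
        exact ⟨⟨n, i⟩, h1, h2⟩
      choose! f hf1 hf2 using hex
      obtain ⟨M, hM⟩ := (htf.image fun q => (f q).1).bddAbove
      refine ⟨M + 1, fun q hq => ?_⟩
      rw [Finset.mem_coe, Finset.mem_image]
      refine ⟨f q, ?_, hf2 q hq⟩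
      rw [Finset.mem_sigma, Finset.mem_range, Finset.mem_filter, Finset.mem_range]
      refine ⟨Nat.lt_succ_of_le (hM ⟨q, hq, rfl⟩), hf1 q hq, ?_⟩
      have := (hts hq).2
      rwa [← hf2 q hq] at this
    obtain ⟨m, hm⟩ := this
    rw [← htk]
    refine (Set.encard_le_encard hm).trans ?_
    rw [Set.encard_coe_eq_coe_finsetCard, hc]
    exact le_iSup (fun m => ((∑ n ∈ Finset.range m, hits B (a n) : ℕ) : ℕ∞)) m
  · rw [← hc, ← Set.encard_coe_eq_coe_finsetCard]
    refine Set.encard_le_encard fun q hq => ?_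
    rw [Finset.mem_coe, Finset.mem_image] at hq
    obtain ⟨s, hs, rfl⟩ := hq
    rw [Finset.mem_sigma, Finset.mem_filter, Finset.mem_range] at hs
    exact ⟨⟨s.1, s.2, Finset.mem_range.1 hs.2.1, rfl⟩, hs.2.2⟩

open scoped Classical in
/-- The configuration made of the selected points of separated sequences. -/
noncomputable def config (a : ℕ → ℕ × (ℕ → EuclideanSpace ℝ (Fin d) × Orientation d)) :
    Config d :=
  -- Separation fails only on a null set in the construction below; the empty default keeps the
  -- value locally finite everywhere. On separated sequences, a bounded set meets finitely many
  -- annuli, each with finitely many selected points.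
  ⟨if IsSeparated a then points a else ∅, by
    intro A hA
    split_ifs with ha
    · obtain ⟨M, hM⟩ := hA.exists_norm_le
      have : ((⋃ n ∈ Finset.range (⌊M⌋₊ + 1), (a n).2 '' (Finset.range (a n).1))).Finite :=
        Set.Finite.biUnion (Finset.finite_toSet _) fun n _ => (Finset.finite_toSet _).image _
      refine this.subset ?_
      rintro q ⟨⟨n, i, hi, rfl⟩, hq⟩
      have h1 := hM _ (mem_prod.1 hq).1
      have h2 := ha.1 (n, i)
      simp only at h2
      refine mem_iUnion₂.2 ⟨n, ?_, ⟨i, by simpa using hi, rfl⟩⟩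
      rw [Finset.mem_range, Nat.lt_succ_iff, ← h2]
      exact Nat.floor_mono h1
    · simp⟩

lemma measurableSet_isSeparated :
    MeasurableSet {a : ℕ → ℕ × (ℕ → EuclideanSpace ℝ (Fin d) × Orientation d) |
      IsSeparated a} := by
  have hm : ∀ p : ℕ × ℕ, Measurable
      fun a : ℕ → ℕ × (ℕ → EuclideanSpace ℝ (Fin d) × Orientation d) => (a p.1).2 p.2 := by
    intro p; fun_prop
  simp only [IsSeparated, ofPred_and, ofPred_forall]
  refine MeasurableSet.inter (MeasurableSet.iInter fun p => ?_)
    (MeasurableSet.iInter fun p => MeasurableSet.iInter fun q => MeasurableSet.iInter fun _ => ?_)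
  · exact measurableSet_eq_fun (Nat.measurable_floor.comp (hm p).fst.norm) measurable_const
  · exact (measurableSet_eq_fun (hm p) (hm q)).compl

/-- A measure which is a sum of diffuse finite measures carried by the annuli
`n ≤ ‖x‖ < n + 1` is the intensity measure of a Poisson point process. -/
theorem exists_isPoissonPointProcess
    (μ : Measure (EuclideanSpace ℝ (Fin d) × Orientation d)) (r : ℕ → NNReal)
    (ν : ℕ → Measure (EuclideanSpace ℝ (Fin d) × Orientation d))
    [∀ n, IsProbabilityMeasure (ν n)]
    (hann : ∀ n, ∀ᵐ q ∂(ν n), ⌊‖q.1‖⌋₊ = n) (hatom : ∀ n q, ν n {q} = 0)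
    (hμ : ∀ B, MeasurableSet B → μ B = ∑' n, r n * ν n B) :
    ∃ (Ω : Type) (_ : MeasurableSpace Ω) (P : Measure Ω) (N : Ω → Config d),
      IsProbabilityMeasure P ∧ IsPoissonPointProcess μ N P := by
  classical
  let E := EuclideanSpace ℝ (Fin d) × Orientation d
  let Q : ℕ → Measure (ℕ × (ℕ → E)) := fun n =>
    (poissonMeasure (r n)).prod (Measure.infinitePi fun _ : ℕ => ν n)
  let P : Measure (ℕ → ℕ × (ℕ → E)) := Measure.infinitePi Q
  have hev : ∀ n, MeasurePreserving (fun a : ℕ → ℕ × (ℕ → E) => a n) P (Q n) :=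
    fun n => measurePreserving_eval_infinitePi Q n
  have hX : ∀ p : ℕ × ℕ, MeasurePreserving (fun a : ℕ → ℕ × (ℕ → E) => (a p.1).2 p.2) P (ν p.1) :=
    fun p => ((measurePreserving_eval_infinitePi (fun _ : ℕ => ν p.1) p.2).comp
      (measurePreserving_snd (μ := poissonMeasure (r p.1)))).comp (hev p.1)
  have hXi : iIndepFun (fun (p : ℕ × ℕ) (a : ℕ → ℕ × (ℕ → E)) => (a p.1).2 p.2) P := by
    refine iIndepFun_uncurry' (X := fun n i (a : ℕ → ℕ × (ℕ → E)) => (a n).2 i)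
      (fun n i => (hX (n, i)).measurable) ?_ fun n => ?_
    · exact iIndepFun_infinitePi (P := Q) (X := fun _ ω => ω.2) (by fun_prop)
    · exact iIndepFun_comp_measurePreserving (X := fun i (x : ℕ → E) => x i) (by fun_prop)
        ((measurePreserving_snd (μ := poissonMeasure (r n))).comp (hev n))
        (iIndepFun_infinitePi (X := fun _ x => x) (fun _ => measurable_id))
  have hsep : ∀ᵐ a ∂P, IsSeparated a := by
    simp only [IsSeparated, Filter.eventually_and, ae_all_iff]
    refine ⟨fun p => (hX p).quasiMeasurePreserving.ae (hann p.1), fun p q hpq => ?_⟩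
    have hl : P.map (fun a => ((a p.1).2 p.2, (a q.1).2 q.2)) = (ν p.1).prod (ν q.1) := by
      rw [(hXi.indepFun hpq).map_prod_eq_prod_map_map (hX p).measurable.aemeasurable
        (hX q).measurable.aemeasurable, (hX p).map_eq, (hX q).map_eq]
    -- By Fubini the diagonal is null, since the second factor has no atoms; hence two independent
    -- points almost surely differ.
    have hdiag : ∀ᵐ z ∂((ν p.1).prod (ν q.1)), z.1 ≠ z.2 := by
      have hmd : MeasurableSet {z : E × E | z.1 = z.2} :=
        measurableSet_eq_fun measurable_fst measurable_snd
      rw [ae_iff]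
      simp only [ne_eq, not_not]
      rw [Measure.measure_prod_null hmd]
      refine .of_forall fun x => ?_
      have : Prod.mk x ⁻¹' {z : E × E | z.1 = z.2} = {x} := by
        ext y; simp [eq_comm]
      exact (congrArg (ν q.1) this).trans (hatom _ _)
    rw [← hl] at hdiag
    exact ae_of_ae_map ((hX p).measurable.prodMk (hX q).measurable).aemeasurable hdiag
  have hcount : ∀ (B : Set E) (a : ℕ → ℕ × (ℕ → E)), count B (config a)
      = if IsSeparated a then natSum (fun n => hits B (a n)) else 0 := by
    intro B a
    simp only [count, config]
    split_ifs with h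
    · exact encard_points_inter h B
    · simp
  have hcount_ae : ∀ B : Set E, (fun a => count B (config a)) =ᵐ[P]
      fun a => natSum (fun n => hits B (a n)) := by
    intro B
    filter_upwards [hsep] with a ha
    exact (hcount B a).trans (if_pos ha)
  have hhm : ∀ B : Set E, MeasurableSet B → ∀ n,
      Measurable fun a : ℕ → ℕ × (ℕ → E) => hits B (a n) :=
    fun B hB n => (measurable_hits hB).comp (measurable_pi_apply n)
  refine ⟨_, _, P, config, inferInstance, ?_, ?_, ?_⟩
  · refine measurable_iff_comap_le.2 ?_
    simp only [instMeasurableSpaceConfig, MeasurableSpace.comap_iSup, iSup_le_iff,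
      MeasurableSpace.comap_comp]
    intro B hB
    refine measurable_iff_comap_le.1 ?_
    have : count B ∘ config = fun a => if IsSeparated a then natSum (fun n => hits B (a n)) else 0 :=
      funext (hcount B)
    rw [this]
    exact Measurable.ite measurableSet_isSeparated
      (measurable_natSum.comp (measurable_pi_lambda _ (hhm B hB))) measurable_const
  · intro B hB hfin
    refine HasLaw.congr ?_ (hcount_ae B)
    refine hasLaw_natSum (r := fun n => r n * (ν n B).toNNReal) (hhm B hB)
      (iIndepFun_infinitePi (X := fun _ => hits B) (fun _ => measurable_hits hB))
      (fun n => (hasLaw_hits (r n) (ν n) hB).comp (hev n).hasLaw) ?_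
    have e : ∀ n, (r n : ℝ≥0∞) * ν n B = ((r n * (ν n B).toNNReal : NNReal) : ℝ≥0∞) := fun n => by
      rw [ENNReal.coe_mul, ENNReal.coe_toNNReal (measure_ne_top _ _)]
    have hs := hμ B hB
    simp only [e] at hs
    rw [hs] at hfin ⊢
    have hsum := ENNReal.tsum_coe_ne_top_iff_summable.1 hfin
    rw [← ENNReal.coe_tsum hsum, ENNReal.toNNReal_coe]
    exact hsum.hasSum
  · intro n B hB hd
    have hd' : Pairwise fun i j => Disjoint (B i) (B j) := hd
    -- The counts are independent over all pairs (annulus, set): across annuli by the product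
    -- structure, within an annulus by thinning. Regrouping by set and summing over annuli gives
    -- independent total counts.
    have hall : iIndepFun (fun (p : ℕ × Fin n) (a : ℕ → ℕ × (ℕ → E)) => hits (B p.2) (a p.1)) P := by
      refine iIndepFun_uncurry' (X := fun m j (a : ℕ → ℕ × (ℕ → E)) => hits (B j) (a m))
        (fun m j => hhm _ (hB j) m) ?_ fun m => ?_
      · exact iIndepFun_infinitePi (P := Q) (X := fun _ ω j => hits (B j) ω)
          (fun _ => measurable_pi_lambda _ fun j => measurable_hits (hB j))
      · exact iIndepFun_comp_measurePreserving (fun j => measurable_hits (hB j)) (hev m)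
          (iIndepFun_hits (r m) (ν m) B hB hd)
    have hg := iIndepFun_group (Y := fun m j (a : ℕ → ℕ × (ℕ → E)) => hits (B j) (a m))
      (fun m j => hhm _ (hB j) m) hall
    exact (hg.comp (fun _ => natSum) (fun _ => measurable_natSum)).congr
      fun j => (hcount_ae (B j)).symm

end Existence

/-! ### Existence of the rigid stick process -/

section RigidProcess

variable {d : ℕ}

lemma intensity_dirac_apply (p : Orientation d) (lam : ℝ)
    {B : Set (EuclideanSpace ℝ (Fin d) × Orientation d)} (hB : MeasurableSet B) :
    intensity (Measure.dirac p) lam B = ENNReal.ofReal lam * volume {x | (x, p) ∈ B} := by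
  rw [intensity, Measure.prod_dirac, Measure.smul_apply, Measure.map_apply (by fun_prop) hB]
  rfl

lemma intensity_dirac_prod_univ (p : Orientation d) (lam : ℝ)
    {A : Set (EuclideanSpace ℝ (Fin d))} (hA : MeasurableSet A) :
    intensity (Measure.dirac p) lam (A ×ˢ univ) = ENNReal.ofReal lam * volume A := by
  rw [intensity_dirac_apply p lam (hA.prod .univ)]
  simp

lemma volume_annulus_pos (hd : 0 < d) (n : ℕ) :
    volume {x : EuclideanSpace ℝ (Fin d) | ⌊‖x‖⌋₊ = n} ≠ 0 := by
  have : Nonempty (Fin d) := ⟨⟨0, hd⟩⟩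
  have hsub : {x : EuclideanSpace ℝ (Fin d) | (n : ℝ) < ‖x‖ ∧ ‖x‖ < n + 1}
      ⊆ {x | ⌊‖x‖⌋₊ = n} := by
    rintro x ⟨h1, h2⟩
    exact (Nat.floor_eq_iff (norm_nonneg x)).2 ⟨h1.le, h2⟩
  have ho : IsOpen {x : EuclideanSpace ℝ (Fin d) | (n : ℝ) < ‖x‖ ∧ ‖x‖ < n + 1} :=
    (isOpen_lt continuous_const continuous_norm).inter (isOpen_lt continuous_norm continuous_const)
  have hne : {x : EuclideanSpace ℝ (Fin d) | (n : ℝ) < ‖x‖ ∧ ‖x‖ < n + 1}.Nonempty := by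
    refine ⟨EuclideanSpace.single ⟨0, hd⟩ ((n : ℝ) + 1 / 2), ?_⟩
    have : ‖EuclideanSpace.single (⟨0, hd⟩ : Fin d) ((n : ℝ) + 1 / 2)‖ = (n : ℝ) + 1 / 2 := by
      rw [PiLp.norm_single, Real.norm_of_nonneg (by positivity)]
    simp only [mem_ofPred_eq, this]
    constructor <;> linarith
  exact ((ho.measure_pos volume hne).trans_le (measure_mono hsub)).ne'

/-- Lebesgue measure is decomposed over the annuli `n ≤ ‖x‖ < n + 1`, which have positive finite
volume and can therefore be normalised to diffuse probability measures. The realization is needed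
only for the upper bound. -/
theorem exists_rigid_process (hd : 0 < d) (p : Orientation d) (lam : ℝ) :
    ∃ (Ω : Type) (_ : MeasurableSpace Ω) (P : Measure Ω) (N : Ω → Config d),
      IsProbabilityMeasure P ∧ IsPoissonPointProcess (intensity (Measure.dirac p) lam) N P := by
  have : Nonempty (Fin d) := ⟨⟨0, hd⟩⟩
  let A : ℕ → Set (EuclideanSpace ℝ (Fin d)) := fun n => {x | ⌊‖x‖⌋₊ = n}
  have hA : ∀ n, MeasurableSet (A n) := fun n =>
    measurableSet_eq_fun (Nat.measurable_floor.comp measurable_norm) measurable_const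
  have hpos : ∀ n, volume (A n) ≠ 0 := volume_annulus_pos hd
  have hfin : ∀ n, volume (A n) ≠ ∞ := fun n => by
    refine ne_top_of_le_ne_top (measure_closedBall_lt_top (x := (0 : EuclideanSpace ℝ (Fin d)))
      (r := n + 1)).ne (measure_mono fun x hx => ?_)
    rw [mem_closedBall_zero_iff]
    exact ((Nat.floor_eq_iff (norm_nonneg x)).1 hx).2.le
  let κ : ℕ → Measure (EuclideanSpace ℝ (Fin d)) := fun n => ProbabilityTheory.cond volume (A n)
  have hκ : ∀ n, IsProbabilityMeasure (κ n) := fun n => cond_isProbabilityMeasure_of_finite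
    (hpos n) (hfin n)
  have hνB : ∀ n {B : Set (EuclideanSpace ℝ (Fin d) × Orientation d)}, MeasurableSet B →
      ((κ n).prod (Measure.dirac p)) B = (volume (A n))⁻¹ * volume (A n ∩ {x | (x, p) ∈ B}) := by
    intro n B hB
    rw [Measure.prod_dirac, Measure.map_apply (by fun_prop) hB]
    exact cond_apply (hA n) _ _
  refine exists_isPoissonPointProcess _
    (fun n => (ENNReal.ofReal lam * volume (A n)).toNNReal)
    (fun n => (κ n).prod (Measure.dirac p)) (fun n => ?_) (fun n q => ?_) fun B hB => ?_
  · rw [Measure.prod_dirac]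
    have hm : MeasurableSet {q : EuclideanSpace ℝ (Fin d) × Orientation d | ⌊‖q.1‖⌋₊ = n} :=
      measurable_fst (hA n)
    exact (ae_map_iff (by fun_prop) hm).2 (ae_cond_mem (hA n))
  · rw [hνB n (measurableSet_singleton q)]
    have : volume (A n ∩ {x | (x, p) ∈ ({q} : Set _)}) = 0 := by
      refine measure_mono_null (t := {q.1}) ?_ (measure_singleton _)
      rintro x ⟨_, hx⟩
      exact congrArg Prod.fst hx
    rw [this, mul_zero]
  · rw [intensity_dirac_apply p lam hB]
    have hm : MeasurableSet {x | (x, p) ∈ B} := by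
      have : Measurable fun x : EuclideanSpace ℝ (Fin d) => (x, p) := by fun_prop
      exact this hB
    have hU : {x | (x, p) ∈ B} = ⋃ n, A n ∩ {x | (x, p) ∈ B} := by
      ext x
      simp [A]
    have hdis : Pairwise (Function.onFun Disjoint fun n => A n ∩ {x | (x, p) ∈ B}) := by
      intro i j hij
      refine Set.disjoint_left.2 fun x hx hx' => hij ?_
      exact (show ⌊‖x‖⌋₊ = i from hx.1).symm.trans hx'.1
    conv_lhs => rw [hU, measure_iUnion hdis fun n => (hA n).inter hm]
    rw [← ENNReal.tsum_mul_left]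
    congr 1
    ext n
    rw [hνB n hB, ENNReal.coe_toNNReal (ENNReal.mul_ne_top ENNReal.ofReal_ne_top (hfin n)),
      mul_assoc, ← mul_assoc (volume (A n)), ENNReal.mul_inv_cancel (hpos n) (hfin n), one_mul]

end RigidProcess

/-! ### Void probabilities and orientations -/

section Counts

variable {d : ℕ} {Ω : Type} [MeasurableSpace Ω]
  {μ : Measure (EuclideanSpace ℝ (Fin d) × Orientation d)} {N : Ω → Config d} {P : Measure Ω}

lemma IsPoissonPointProcess.measure_count_eq_zero (h : IsPoissonPointProcess μ N P)
    {B : Set (EuclideanSpace ℝ (Fin d) × Orientation d)} (hB : MeasurableSet B) (hf : μ B ≠ ∞) :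
    P {a | count B (N a) = 0} = ENNReal.ofReal (Real.exp (-(μ B).toReal)) := by
  rw [(h.hasLaw_count B hB hf).measure_eq (p := fun x => x = 0) MeasurableSet.of_discrete,
    Measure.map_apply (measurable_of_countable _) MeasurableSet.of_discrete]
  have : (fun k : ℕ => (k : ℕ∞)) ⁻¹' {x | x = 0} = {0} := by
    ext; simp
  rw [this, poissonMeasure_singleton]
  simp [ENNReal.coe_toNNReal_eq_toReal]

lemma count_eq_zero_iff {B : Set (EuclideanSpace ℝ (Fin d) × Orientation d)} {ω : Config d} :
    count B ω = 0 ↔ ∀ q ∈ ω.1, q ∉ B := by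
  rw [count, Set.encard_eq_zero, ← Set.disjoint_iff_inter_eq_empty, Set.disjoint_left]

lemma measurable_count {B : Set (EuclideanSpace ℝ (Fin d) × Orientation d)}
    (hB : MeasurableSet B) : Measurable (count B) :=
  measurable_iff_comap_le.2 (le_iSup₂_of_le (f := fun (B : Set (EuclideanSpace ℝ (Fin d) ×
    Orientation d)) (_ : MeasurableSet B) => MeasurableSpace.comap (count B) inferInstance)
    B hB le_rfl)

/-- The probability is `1 - exp (-μ B)`, and `1 - exp (-x) ≤ x`. -/
lemma IsPoissonPointProcess.measure_count_ne_zero_le [IsProbabilityMeasure P]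
    (h : IsPoissonPointProcess μ N P)
    {B : Set (EuclideanSpace ℝ (Fin d) × Orientation d)} (hB : MeasurableSet B) (hf : μ B ≠ ∞) :
    P {a | count B (N a) ≠ 0} ≤ μ B := by
  have hm : MeasurableSet {a | count B (N a) = 0} :=
    ((measurable_count hB).comp h.measurable) (measurableSet_singleton 0)
  have : {a | count B (N a) ≠ 0} = {a | count B (N a) = 0}ᶜ := rfl
  rw [this, prob_compl_eq_one_sub hm, h.measure_count_eq_zero hB hf, ← ENNReal.ofReal_one,
    ← ENNReal.ofReal_sub _ (Real.exp_pos _).le]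
  refine ENNReal.ofReal_le_of_le_toReal ?_
  linarith [Real.add_one_le_exp (-(μ B).toReal)]

lemma IsPoissonPointProcess.ae_orientation_eq [IsProbabilityMeasure P] {p : Orientation d}
    {lam : ℝ} (h : IsPoissonPointProcess (intensity (Measure.dirac p) lam) N P) :
    ∀ᵐ a ∂P, ∀ q ∈ (N a).1, q.2 = p := by
  have hm : MeasurableSet {q : EuclideanSpace ℝ (Fin d) × Orientation d | q.2 ≠ p} :=
    (measurableSet_eq_fun measurable_snd measurable_const).compl
  have h0 : intensity (Measure.dirac p) lam
      {q : EuclideanSpace ℝ (Fin d) × Orientation d | q.2 ≠ p} = 0 := by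
    rw [intensity_dirac_apply p lam hm]
    simp
  have := h.measure_count_ne_zero_le hm (by simp [h0])
  rw [h0, nonpos_iff_eq_zero] at this
  have h2 : ∀ᵐ a ∂P, count {q : EuclideanSpace ℝ (Fin d) × Orientation d | q.2 ≠ p} (N a) = 0 := by
    rw [ae_iff]; exact this
  filter_upwards [h2] with a ha q hq
  by_contra hne
  exact count_eq_zero_iff.1 ha q hq hne

end Counts

/-! ### Intersection of parallel sticks -/

section Geometry

variable {n : ℕ}

/-- The coordinates of `x` other than the `k`-th one. -/
def perp (k : Fin (n + 1)) (x : EuclideanSpace ℝ (Fin (n + 1))) : EuclideanSpace ℝ (Fin n) :=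
  WithLp.toLp 2 fun i => x (k.succAbove i)

@[simp] lemma perp_apply (k : Fin (n + 1)) (x : EuclideanSpace ℝ (Fin (n + 1))) (i : Fin n) :
    perp k x i = x (k.succAbove i) := rfl

lemma perp_sub (k : Fin (n + 1)) (x y : EuclideanSpace ℝ (Fin (n + 1))) :
    perp k (x - y) = perp k x - perp k y := rfl

lemma perp_smul (k : Fin (n + 1)) (c : ℝ) (x : EuclideanSpace ℝ (Fin (n + 1))) :
    perp k (c • x) = c • perp k x := rfl

lemma norm_sq_eq_perp (k : Fin (n + 1)) (x : EuclideanSpace ℝ (Fin (n + 1))) :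
    ‖x‖ ^ 2 = x k ^ 2 + ‖perp k x‖ ^ 2 := by
  rw [EuclideanSpace.norm_sq_eq, EuclideanSpace.norm_sq_eq, Fin.sum_univ_succAbove _ k]
  simp

lemma norm_perp_le (k : Fin (n + 1)) (x : EuclideanSpace ℝ (Fin (n + 1))) :
    ‖perp k x‖ ≤ ‖x‖ := by
  have := norm_sq_eq_perp k x
  nlinarith [norm_nonneg x, norm_nonneg (perp k x), sq_nonneg (x k)]

lemma abs_apply_le_norm (k : Fin (n + 1)) (x : EuclideanSpace ℝ (Fin (n + 1))) :
    |x k| ≤ ‖x‖ := PiLp.norm_apply_le x k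

lemma measurePreserving_coord_perp (k : Fin (n + 1)) :
    MeasurePreserving (fun x : EuclideanSpace ℝ (Fin (n + 1)) => (x k, perp k x))
      volume (volume.prod volume) := by
  have h1 := PiLp.volume_preserving_ofLp (Fin (n + 1))
  have h2 := volume_preserving_piFinSuccAbove (fun _ : Fin (n + 1) => ℝ) k
  have h3 := (MeasurePreserving.id (volume : Measure ℝ)).prod
    (PiLp.volume_preserving_toLp (Fin n))
  exact h3.comp (h2.comp h1)

lemma volume_coord_perp (k : Fin (n + 1)) {S : Set ℝ} {T : Set (EuclideanSpace ℝ (Fin n))}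
    (hS : MeasurableSet S) (hT : MeasurableSet T) :
    volume {x : EuclideanSpace ℝ (Fin (n + 1)) | x k ∈ S ∧ perp k x ∈ T}
      = volume S * volume T := by
  rw [← Measure.prod_prod, ← (measurePreserving_coord_perp k).measure_preimage
    (hS.prod hT).nullMeasurableSet]
  rfl

/-- The segment is compact and nonempty, so the infimum distance is attained. -/
lemma mem_stick_iff {d : ℕ} {L : ℝ} (hL : 0 < L) (x y : EuclideanSpace ℝ (Fin d))
    (p : Orientation d) :
    y ∈ stick L x p ↔ ∃ t : ℝ, |t| ≤ L / 2 ∧ ‖y - x - t • (p : EuclideanSpace ℝ (Fin d))‖ ≤ 1 := by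
  have himg : segment L x p = (fun t : ℝ => x + t • (p : EuclideanSpace ℝ (Fin d))) ''
      Icc (-L / 2) (L / 2) := by
    ext z
    simp only [segment, mem_ofPred_eq, mem_image, mem_Icc]
    constructor
    · rintro ⟨t, h1, h2, rfl⟩; exact ⟨t, ⟨h1, h2⟩, rfl⟩
    · rintro ⟨t, ⟨h1, h2⟩, rfl⟩; exact ⟨t, h1, h2, rfl⟩
  have hc : IsCompact (segment L x p) := himg ▸ isCompact_Icc.image (by fun_prop)
  have hne : (segment L x p).Nonempty := himg ▸ (nonempty_Icc.2 (by linarith)).image _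
  constructor
  · intro hy
    obtain ⟨z, ⟨t, h1, h2, rfl⟩, hz⟩ := hc.exists_infDist_eq_dist hne y
    refine ⟨t, abs_le.2 ⟨by linarith, h2⟩, ?_⟩
    have : Metric.infDist y (segment L x p) ≤ 1 := hy
    rwa [hz, dist_eq_norm, ← sub_sub] at this
  · rintro ⟨t, ht, h⟩
    rw [abs_le] at ht
    have hz : x + t • (p : EuclideanSpace ℝ (Fin d)) ∈ segment L x p :=
      ⟨t, by linarith, ht.2, rfl⟩
    refine (Metric.infDist_le_dist_of_mem hz).trans ?_
    rwa [dist_eq_norm, ← sub_sub]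

lemma isClosed_stick {d : ℕ} (L : ℝ) (x : EuclideanSpace ℝ (Fin d)) (p : Orientation d) :
    IsClosed (stick L x p) :=
  isClosed_le (Metric.continuous_infDist_pt _) continuous_const

lemma isPreconnected_stick {d : ℕ} {L : ℝ} (hL : 0 < L) (x : EuclideanSpace ℝ (Fin d))
    (p : Orientation d) : IsPreconnected (stick L x p) := by
  refine Convex.isPreconnected fun y hy z hz a b ha hb hab => ?_
  rw [mem_stick_iff hL] at hy hz ⊢
  obtain ⟨s, hs, hy⟩ := hy
  obtain ⟨t, ht, hz⟩ := hz
  refine ⟨a * s + b * t, ?_, ?_⟩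
  · rw [abs_le] at *
    constructor <;> nlinarith
  · have e : a • y + b • z - x - (a * s + b * t) • (p : EuclideanSpace ℝ (Fin d))
        = a • (y - x - s • (p : EuclideanSpace ℝ (Fin d)))
          + b • (z - x - t • (p : EuclideanSpace ℝ (Fin d))) := by
      have : x = (a + b) • x := by rw [hab, one_smul]
      conv_lhs => rw [this]
      module
    rw [e]
    refine (norm_add_le _ _).trans ?_
    rw [norm_smul, norm_smul, Real.norm_of_nonneg ha, Real.norm_of_nonneg hb]
    nlinarith

lemma self_mem_stick {d : ℕ} {L : ℝ} (hL : 0 < L) (x : EuclideanSpace ℝ (Fin d))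
    (p : Orientation d) : x ∈ stick L x p :=
  (mem_stick_iff hL x x p).2 ⟨0, by simp; positivity, by simp⟩

lemma norm_orientation {d : ℕ} (p : Orientation d) : ‖(p : EuclideanSpace ℝ (Fin d))‖ = 1 :=
  mem_sphere_zero_iff_norm.1 p.2

lemma dist_le_of_mem_stick {d : ℕ} {L : ℝ} (hL : 0 < L) {x y : EuclideanSpace ℝ (Fin d)}
    {p : Orientation d} (h : y ∈ stick L x p) : dist y x ≤ L / 2 + 1 := by
  obtain ⟨t, ht, hy⟩ := (mem_stick_iff hL x y p).1 h
  rw [dist_eq_norm]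
  calc ‖y - x‖ = ‖(y - x - t • (p : EuclideanSpace ℝ (Fin d)))
        + t • (p : EuclideanSpace ℝ (Fin d))‖ := by rw [sub_add_cancel]
    _ ≤ 1 + |t| * 1 := by
        refine (norm_add_le _ _).trans (add_le_add hy ?_)
        rw [norm_smul, norm_orientation, Real.norm_eq_abs]
    _ ≤ L / 2 + 1 := by linarith

/-- A common point is within 1 of both segments, so the difference of centres is within 2 of a
vector along the axis of length at most `L`. -/
lemma sub_bounds_of_sticks_meet {L : ℝ} (hL : 0 < L) {k : Fin (n + 1)} {p : Orientation (n + 1)}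
    (hp : (p : EuclideanSpace ℝ (Fin (n + 1))) = EuclideanSpace.single k 1)
    {x x' : EuclideanSpace ℝ (Fin (n + 1))} (h : (stick L x p ∩ stick L x' p).Nonempty) :
    ‖perp k (x' - x)‖ ≤ 2 ∧ |(x' - x) k| ≤ L + 2 := by
  obtain ⟨y, hy, hy'⟩ := h
  obtain ⟨s, hs, hy⟩ := (mem_stick_iff hL x y p).1 hy
  obtain ⟨t, ht, hy'⟩ := (mem_stick_iff hL x' y p).1 hy'
  have hb : ‖x' - x - (s - t) • (p : EuclideanSpace ℝ (Fin (n + 1)))‖ ≤ 2 := by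
    have e : x' - x - (s - t) • (p : EuclideanSpace ℝ (Fin (n + 1)))
        = (y - x - s • (p : EuclideanSpace ℝ (Fin (n + 1))))
          - (y - x' - t • (p : EuclideanSpace ℝ (Fin (n + 1)))) := by module
    rw [e]
    refine (norm_sub_le _ _).trans (by linarith)
  constructor
  · refine le_trans (le_of_eq ?_) ((norm_perp_le k _).trans hb)
    congr 1
    ext i
    simp [hp, Fin.succAbove_ne]
  · have h1 := (abs_apply_le_norm k _).trans hb
    have e : (x' - x - (s - t) • (p : EuclideanSpace ℝ (Fin (n + 1)))) k
        = (x' - x) k - (s - t) := by simp [hp]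
    rw [e] at h1
    rw [abs_le] at *
    constructor <;> linarith

/-- The midpoint of the two centres lies in both sticks: it is at distance half the transverse
separation from each axis, and its projection on each axis falls inside the segment. -/
lemma sticks_meet {L : ℝ} (hL : 0 < L) {k : Fin (n + 1)} {p : Orientation (n + 1)}
    (hp : (p : EuclideanSpace ℝ (Fin (n + 1))) = EuclideanSpace.single k 1)
    {x x' : EuclideanSpace ℝ (Fin (n + 1))} (h1 : ‖perp k (x' - x)‖ ≤ 2)
    (h2 : |(x' - x) k| ≤ L) : (stick L x p ∩ stick L x' p).Nonempty := by
  set u := x' - x with hu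
  have key : ‖(1 / 2 : ℝ) • u - (u k / 2) • (p : EuclideanSpace ℝ (Fin (n + 1)))‖ ≤ 1 := by
    set w := (1 / 2 : ℝ) • u - (u k / 2) • (p : EuclideanSpace ℝ (Fin (n + 1))) with hw
    have e1 : w k = 0 := by simp [hw, hp]; ring
    have e2 : perp k w = (1 / 2 : ℝ) • perp k u := by
      ext i
      simp [hw, hp, Fin.succAbove_ne]
    have := norm_sq_eq_perp k w
    rw [e1, e2, norm_smul, Real.norm_of_nonneg (by norm_num)] at this
    nlinarith [norm_nonneg w, norm_nonneg (perp k u)]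
  have h3 : |u k / 2| ≤ L / 2 := by rw [abs_div, abs_two]; linarith
  refine ⟨x + (1 / 2 : ℝ) • u, (mem_stick_iff hL _ _ p).2 ⟨u k / 2, h3, ?_⟩,
    (mem_stick_iff hL _ _ p).2 ⟨-(u k / 2), by rwa [abs_neg], ?_⟩⟩
  · rwa [add_sub_cancel_left]
  · have e : x + (1 / 2 : ℝ) • u - x' - (-(u k / 2)) • (p : EuclideanSpace ℝ (Fin (n + 1)))
        = -((1 / 2 : ℝ) • u - (u k / 2) • (p : EuclideanSpace ℝ (Fin (n + 1)))) := by
      rw [hu]; module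
    rwa [e, norm_neg]

end Geometry

/-! ### Self-avoiding paths and finite clusters -/

section LatticePaths

variable {V : Type*} [AddCommGroup V]

/-- The vertex reached from `z` after the first `i` of the steps `f`. -/
def pathVertex (z : V) {m : ℕ} (f : Fin m → V) (i : ℕ) : V :=
  z + ∑ j : Fin m, if (j : ℕ) < i then f j else 0

lemma pathVertex_increments (g : ℕ → V) {m i : ℕ} (hi : i ≤ m) :
    pathVertex (g 0) (fun j : Fin m => g (j + 1) - g j) i = g i := by
  rw [pathVertex, Fin.sum_univ_eq_sum_range (fun j => if j < i then g (j + 1) - g j else 0),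
    ← Finset.sum_filter]
  have : (Finset.range m).filter (fun j => j < i) = Finset.range i := by
    ext j
    simp only [Finset.mem_filter, Finset.mem_range]
    omega
  rw [this, Finset.sum_range_sub, add_sub_cancel]

/-- There is a self-avoiding path of `m` steps in `F` from `z` with all its vertices in `O`. -/
def HasPath (O : Set V) (F : Finset V) (z : V) (m : ℕ) : Prop :=
  ∃ f ∈ Fintype.piFinset (fun _ : Fin m => F),
    (Function.Injective fun i : Fin (m + 1) => pathVertex z f i) ∧
      ∀ i : Fin (m + 1), pathVertex z f i ∈ O

/-- If there is no self-avoiding path of `m` steps from `z`, then the cluster of `z` is finite. -/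
lemma exists_finite_cluster {O : Set V} {F : Finset V} (h0 : 0 ∈ F) (hneg : ∀ f ∈ F, -f ∈ F)
    {z₀ : V} (hz₀ : z₀ ∈ O) {m : ℕ} (hno : ¬ HasPath O F z₀ m) :
    ∃ C : Set V, C.Finite ∧ z₀ ∈ C ∧ ∀ z ∈ C, ∀ z' ∈ O, z' - z ∈ F → z' ∈ C := by
  classical
  let G : SimpleGraph V := SimpleGraph.fromRel fun z z' => z ∈ O ∧ z' ∈ O ∧ z' - z ∈ F
  have hG : ∀ {z z'}, G.Adj z z' → z ∈ O ∧ z' ∈ O ∧ z' - z ∈ F := by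
    rintro z z' ⟨_, h | ⟨h1, h2, h3⟩⟩
    · exact h
    · exact ⟨h2, h1, by simpa using hneg _ h3⟩
  refine ⟨{z | z ∈ O ∧ G.Reachable z₀ z}, ?_, ⟨hz₀, .refl _⟩, ?_⟩
  · refine ((Fintype.piFinset (fun _ : Fin m => F)).finite_toSet.image
      fun f => pathVertex z₀ f m).subset ?_
    rintro z ⟨hz, ⟨w⟩⟩
    -- A simple path to `z`, continued constantly past its end (hence `0 ∈ F`), gives `m` steps in
    -- `F`. If its length were at least `m`, its first `m` steps would be a forbidden self-avoiding
    -- path; so it ends by time `m`, and the cluster is covered by the finitely many endpoints of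
    -- step sequences.
    let q := w.toPath
    let g : ℕ → V := (q : G.Walk z₀ z).getVert
    have hg0 : g 0 = z₀ := SimpleGraph.Walk.getVert_zero _
    have hO : ∀ i, g i ∈ O := by
      intro i
      rcases lt_or_ge i (q : G.Walk z₀ z).length with hi | hi
      · exact (hG ((q : G.Walk z₀ z).adj_getVert_succ hi)).1
      · simp only [g, SimpleGraph.Walk.getVert_of_length_le _ hi, hz]
    have hstep : ∀ i, g (i + 1) - g i ∈ F := by
      intro i
      rcases lt_or_ge i (q : G.Walk z₀ z).length with hi | hi
      · exact (hG ((q : G.Walk z₀ z).adj_getVert_succ hi)).2.2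
      · simp only [g, SimpleGraph.Walk.getVert_of_length_le _ hi,
          SimpleGraph.Walk.getVert_of_length_le _ (hi.trans (Nat.le_succ i)), sub_self, h0]
    have hmem : (fun j : Fin m => g (j + 1) - g j) ∈ Fintype.piFinset (fun _ : Fin m => F) :=
      Fintype.mem_piFinset.2 fun j => hstep j
    have hv : ∀ i ≤ m, pathVertex z₀ (fun j : Fin m => g (j + 1) - g j) i = g i := by
      intro i hi
      rw [← hg0]
      exact pathVertex_increments g hi
    refine ⟨_, hmem, ?_⟩
    change pathVertex z₀ (fun j : Fin m => g (j + 1) - g j) m = z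
    rw [hv m le_rfl]
    refine SimpleGraph.Walk.getVert_of_length_le _ ?_
    by_contra hlt
    push Not at hlt
    refine hno ⟨_, hmem, fun i j hij => ?_, fun i => ?_⟩
    · simp only at hij
      rw [hv i (Nat.lt_succ_iff.1 i.2), hv j (Nat.lt_succ_iff.1 j.2)] at hij
      have hi := i.2
      have hj := j.2
      exact Fin.ext (q.2.getVert_injOn (by simp only [mem_ofPred_eq]; omega)
        (by simp only [mem_ofPred_eq]; omega) hij)
    · rw [hv i (Nat.lt_succ_iff.1 i.2)]
      exact hO i
  · rintro z ⟨hz, hr⟩ z' hz' hF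
    refine ⟨hz', ?_⟩
    by_cases hne : z = z'
    · exact hne ▸ hr
    · exact hr.trans (SimpleGraph.Adj.reachable ⟨hne, Or.inl ⟨hz, hz', hF⟩⟩)

end LatticePaths

/-! ### Discretisation by small cubes -/

section Cubes

variable {d : ℕ}

/-- The index of the cube of side `ε` that contains `x`. -/
noncomputable def cubeIndex (ε : ℝ) (x : EuclideanSpace ℝ (Fin d)) : Fin d → ℤ := fun i => ⌊x i / ε⌋

/-- The half-open cube of side `ε` with index `z`. -/
def cube (ε : ℝ) (z : Fin d → ℤ) : Set (EuclideanSpace ℝ (Fin d)) := {x | cubeIndex ε x = z}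

lemma cube_eq_preimage {ε : ℝ} (hε : 0 < ε) (z : Fin d → ℤ) :
    cube ε z = WithLp.ofLp ⁻¹' (univ.pi fun i => Ico (ε * z i) (ε * (z i + 1))) := by
  ext x
  simp only [cube, cubeIndex, mem_ofPred_eq, funext_iff, mem_preimage, mem_univ_pi, mem_Ico]
  refine forall_congr' fun i => ?_
  rw [Int.floor_eq_iff, le_div_iff₀ hε, div_lt_iff₀ hε, mul_comm ε, mul_comm ε]

lemma measurableSet_cube {ε : ℝ} (hε : 0 < ε) (z : Fin d → ℤ) : MeasurableSet (cube ε z) := by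
  rw [cube_eq_preimage hε]
  exact (PiLp.volume_preserving_ofLp (Fin d)).measurable
    (MeasurableSet.univ_pi fun _ => measurableSet_Ico)

lemma volume_cube {ε : ℝ} (hε : 0 < ε) (z : Fin d → ℤ) :
    volume (cube ε z) = ENNReal.ofReal ε ^ d := by
  rw [cube_eq_preimage hε, (PiLp.volume_preserving_ofLp (Fin d)).measure_preimage
    (MeasurableSet.univ_pi fun _ => measurableSet_Ico).nullMeasurableSet, Real.volume_pi_Ico]
  simp [mul_add]

lemma disjoint_cube (ε : ℝ) {z z' : Fin d → ℤ} (h : z ≠ z') : Disjoint (cube ε z) (cube ε z') :=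
  Set.disjoint_left.2 fun _ hx hx' => h (Eq.trans (Eq.symm hx) hx')

lemma isBounded_cube {ε : ℝ} (hε : 0 < ε) (z : Fin d → ℤ) : Bornology.IsBounded (cube ε z) := by
  rw [cube_eq_preimage hε]
  exact (PiLp.antilipschitzWith_ofLp 2 _).isBounded_preimage
    (Bornology.IsBounded.pi fun _ => Metric.isBounded_Ico _ _)

/-- The indices of the cubes containing a point of a configuration. -/
def occupiedCubes (ε : ℝ) (ω : Config d) : Set (Fin d → ℤ) :=
  {z | count (cube ε z ×ˢ univ) ω ≠ 0}

lemma mem_occupiedCubes {ε : ℝ} {ω : Config d} {q : EuclideanSpace ℝ (Fin d) × Orientation d}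
    (hq : q ∈ ω.1) : cubeIndex ε q.1 ∈ occupiedCubes ε ω := fun h =>
  count_eq_zero_iff.1 h q hq ⟨rfl, trivial⟩

/-- Union bound over the `F.card ^ m` step sequences. Self-avoidance makes the `m + 1` cubes visited
distinct, so their occupation events are independent. -/
lemma measure_hasPath_le {Ω : Type} [MeasurableSpace Ω] {P : Measure Ω} [IsProbabilityMeasure P]
    {N : Ω → Config d} {p : Orientation d} {lam : ℝ}
    (h : IsPoissonPointProcess (intensity (Measure.dirac p) lam) N P) {ε : ℝ} (hε : 0 < ε)
    (F : Finset (Fin d → ℤ)) (z : Fin d → ℤ) (m : ℕ) :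
    P {a | HasPath (occupiedCubes ε (N a)) F z m} ≤
      (F.card : ℝ≥0∞) ^ m * (ENNReal.ofReal lam * ENNReal.ofReal ε ^ d) ^ (m + 1) := by
  classical
  set c := ENNReal.ofReal lam * ENNReal.ofReal ε ^ d
  have hm : ∀ z : Fin d → ℤ, MeasurableSet (cube ε z ×ˢ (univ : Set (Orientation d))) :=
    fun z => (measurableSet_cube hε z).prod .univ
  have hc : ∀ z : Fin d → ℤ, intensity (Measure.dirac p) lam (cube ε z ×ˢ (univ : Set (Orientation d))) = c :=
    fun z => by rw [intensity_dirac_prod_univ p lam (measurableSet_cube hε z), volume_cube hε]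
  have hcf : c ≠ ∞ := ENNReal.mul_ne_top ENNReal.ofReal_ne_top
    (ENNReal.pow_ne_top ENNReal.ofReal_ne_top)
  have hone : ∀ z : Fin d → ℤ, P {a | count (cube ε z ×ˢ univ) (N a) ≠ 0} ≤ c := fun z => by
    rw [← hc z]
    exact h.measure_count_ne_zero_le (hm z) (by rwa [hc z])
  have hsub : {a | HasPath (occupiedCubes ε (N a)) F z m} ⊆
      ⋃ f ∈ Fintype.piFinset (fun _ : Fin m => F),
        {a | (Function.Injective fun i : Fin (m + 1) => pathVertex z f i) ∧
          ∀ i : Fin (m + 1), pathVertex z f i ∈ occupiedCubes ε (N a)} := by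
    rintro a ⟨f, hf, h1, h2⟩
    exact mem_iUnion₂.2 ⟨f, hf, h1, h2⟩
  refine (measure_mono hsub).trans ((measure_biUnion_finset_le _ _).trans ?_)
  have hf : ∀ f : Fin m → Fin d → ℤ,
      P {a | (Function.Injective fun i : Fin (m + 1) => pathVertex z f i) ∧
          ∀ i : Fin (m + 1), pathVertex z f i ∈ occupiedCubes ε (N a)} ≤ c ^ (m + 1) := by
    intro f
    by_cases hinj : Function.Injective fun i : Fin (m + 1) => pathVertex z f i
    · have hind := h.indep_count (m + 1) (fun i => cube ε (pathVertex z f i) ×ˢ univ)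
        (fun i => hm _) (fun i j hij => Set.disjoint_prod.2
          (Or.inl (disjoint_cube ε fun h' => hij (hinj h'))))
      have := hind.measure_inter_preimage_eq_mul Finset.univ (sets := fun _ => {0}ᶜ)
        (fun _ _ => MeasurableSet.of_discrete)
      have e : {a | (Function.Injective fun i : Fin (m + 1) => pathVertex z f i) ∧
          ∀ i : Fin (m + 1), pathVertex z f i ∈ occupiedCubes ε (N a)} =
          ⋂ i ∈ Finset.univ, (fun a => count (cube ε (pathVertex z f (i : Fin (m + 1))) ×ˢ univ)
            (N a)) ⁻¹' {0}ᶜ := by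
        ext a
        simp [hinj, occupiedCubes]
      rw [e, this]
      refine (Finset.prod_le_prod' (g := fun _ => c)
        fun (i : Fin (m + 1)) _ => hone (pathVertex z f i)).trans ?_
      simp
    · simp [hinj]
  refine (Finset.sum_le_sum fun f _ => hf f).trans ?_
  simp [Fintype.card_piFinset]

/-- If all the clusters of cubes are finite then there is no percolation. -/
lemma not_percolates_of_finite_clusters {L ε : ℝ} (hL : 0 < L) (hε : 0 < ε) {ω : Config d}
    {F : Finset (Fin d → ℤ)}
    (hF : ∀ q ∈ ω.1, ∀ q' ∈ ω.1, (stick L q.1 q.2 ∩ stick L q'.1 q'.2).Nonempty →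
      cubeIndex ε q'.1 - cubeIndex ε q.1 ∈ F)
    (hC : ∀ z₀ ∈ occupiedCubes ε ω, ∃ C : Set (Fin d → ℤ), C.Finite ∧ z₀ ∈ C ∧
      ∀ z ∈ C, ∀ z' ∈ occupiedCubes ε ω, z' - z ∈ F → z' ∈ C) :
    ¬ Percolates L ω := by
  rintro ⟨x, hx, hub⟩
  obtain ⟨q₀, hq₀, hxq⟩ := mem_iUnion₂.1 hx
  obtain ⟨C, hCf, hzC, hCc⟩ := hC _ (mem_occupiedCubes hq₀)
  set S : Set (EuclideanSpace ℝ (Fin d) × Orientation d) := {q ∈ ω.1 | cubeIndex ε q.1 ∈ C}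
  set T : Set (EuclideanSpace ℝ (Fin d) × Orientation d) := {q ∈ ω.1 | cubeIndex ε q.1 ∉ C}
  have hSf : S.Finite := by
    have hb : Bornology.IsBounded (⋃ z ∈ C, cube ε z) :=
      (Bornology.isBounded_biUnion hCf).2 fun z _ => isBounded_cube hε z
    refine (ω.2 _ hb).subset ?_
    rintro q ⟨h1, h2⟩
    exact ⟨h1, mem_iUnion₂.2 ⟨_, h2, rfl⟩, trivial⟩
  -- `A` collects the sticks of the finite cluster and `B` all the others. Both are closed, `B` by
  -- local finiteness, and closure of `C` under `F`-steps makes them disjoint; a connected component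
  -- meeting `A` therefore stays in the bounded set `A`.
  set A : Set (EuclideanSpace ℝ (Fin d)) := ⋃ q ∈ S, stick L q.1 q.2
  set B : Set (EuclideanSpace ℝ (Fin d)) := ⋃ q ∈ T, stick L q.1 q.2
  have hA : IsClosed A := hSf.isClosed_biUnion fun q _ => isClosed_stick L q.1 q.2
  have hAb : Bornology.IsBounded A := (Bornology.isBounded_biUnion hSf).2 fun q _ =>
    (Metric.isBounded_closedBall (x := q.1) (r := L / 2 + 1)).subset
      fun y hy => dist_le_of_mem_stick hL hy
  have hB : IsClosed B := by
    have hlf : LocallyFinite fun q : T => stick L q.1.1 q.1.2 := by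
      intro y
      refine ⟨Metric.ball y 1, Metric.ball_mem_nhds y one_pos, ?_⟩
      have hfin := ω.2 (Metric.closedBall y (L / 2 + 2)) Metric.isBounded_closedBall
      refine Set.Finite.of_finite_image (f := Subtype.val) (hfin.subset ?_)
        Subtype.val_injective.injOn
      rintro _ ⟨q, ⟨w, hw1, hw2⟩, rfl⟩
      refine ⟨q.2.1, ?_, trivial⟩
      have h1 := dist_le_of_mem_stick hL hw1
      have h2 := Metric.mem_ball.1 hw2
      rw [Metric.mem_closedBall]
      have := dist_triangle q.1.1 w y
      rw [dist_comm q.1.1 w] at this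
      linarith
    have := hlf.isClosed_iUnion fun q => isClosed_stick L q.1.1 q.1.2
    rwa [iUnion_subtype] at this
  have hcov : occupied L ω ⊆ A ∪ B := by
    intro y hy
    obtain ⟨q, hq, hyq⟩ := mem_iUnion₂.1 hy
    by_cases hqC : cubeIndex ε q.1 ∈ C
    · exact Or.inl (mem_iUnion₂.2 ⟨q, ⟨hq, hqC⟩, hyq⟩)
    · exact Or.inr (mem_iUnion₂.2 ⟨q, ⟨hq, hqC⟩, hyq⟩)
  have hdis : A ∩ B = ∅ := by
    rw [← Set.disjoint_iff_inter_eq_empty, Set.disjoint_left]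
    intro y hyA hyB
    obtain ⟨q, hq, hyq⟩ := mem_iUnion₂.1 hyA
    obtain ⟨q', hq', hyq'⟩ := mem_iUnion₂.1 hyB
    exact hq'.2 (hCc _ hq.2 _ (mem_occupiedCubes hq'.1) (hF q hq.1 q' hq'.1 ⟨y, hyq, hyq'⟩))
  refine hub (hAb.subset fun y hy => ?_)
  by_contra hyA
  have hsubK := connectedComponentIn_subset (occupied L ω) x
  have hyB : y ∈ B := (hcov (hsubK hy)).resolve_left hyA
  obtain ⟨w, _, hw⟩ := isPreconnected_closed_iff.1 (isPreconnected_connectedComponentIn (x := x)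
    (F := occupied L ω)) A B hA hB (hsubK.trans hcov)
    ⟨x, mem_connectedComponentIn hx, mem_iUnion₂.2 ⟨q₀, ⟨hq₀, hzC⟩, hxq⟩⟩ ⟨y, hy, hyB⟩
  rw [hdis] at hw
  exact hw

end Cubes

/-! ### Absence of percolation at small intensity -/

section Subcritical

variable {n : ℕ}

/-- The volume of the unit ball of `ℝ^n`, for `n ≥ 1`. -/
noncomputable def unitBallVolume (n : ℕ) : ℝ :=
  √Real.pi ^ n / Real.Gamma ((n : ℝ) / 2 + 1)

lemma unitBallVolume_pos (n : ℕ) : 0 < unitBallVolume n :=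
  div_pos (by positivity) (Real.Gamma_pos_of_pos (by positivity))

lemma volume_closedBall_eq (hn : 0 < n) (x : EuclideanSpace ℝ (Fin n)) {r : ℝ} (hr : 0 ≤ r) :
    volume (Metric.closedBall x r) = ENNReal.ofReal (r ^ n * unitBallVolume n) := by
  have : Nonempty (Fin n) := ⟨⟨0, hn⟩⟩
  rw [EuclideanSpace.volume_closedBall, Fintype.card_fin, ENNReal.ofReal_mul (by positivity),
    ENNReal.ofReal_pow hr]
  rfl

/-- The differences of the indices of cubes of side `ε` whose centres may be the centres of two
intersecting sticks. -/
def neighbours (k : Fin (n + 1)) (L ε : ℝ) : Set (Fin (n + 1) → ℤ) :=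
  {z | ∃ u : EuclideanSpace ℝ (Fin (n + 1)), ‖perp k u‖ ≤ 2 ∧ |u k| ≤ L + 2 ∧
    ∀ i, |u i - ε * z i| < ε}

lemma neg_mem_neighbours {k : Fin (n + 1)} {L ε : ℝ} {z : Fin (n + 1) → ℤ}
    (h : z ∈ neighbours k L ε) : -z ∈ neighbours k L ε := by
  obtain ⟨u, h1, h2, h3⟩ := h
  refine ⟨-u, ?_, ?_, fun i => ?_⟩
  · rwa [← neg_one_smul ℝ, perp_smul, norm_smul, norm_neg, norm_one, one_mul]
  · simpa using h2
  · have := h3 i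
    rw [← abs_neg] at this
    convert this using 2
    simp
    ring

lemma zero_mem_neighbours {k : Fin (n + 1)} {L ε : ℝ} (hL : 0 < L) (hε : 0 < ε) :
    0 ∈ neighbours k L ε := by
  refine ⟨0, ?_, ?_, fun i => by simpa using hε⟩
  · have : perp k (0 : EuclideanSpace ℝ (Fin (n + 1))) = 0 := rfl
    simp [this]
  · simp; positivity

lemma cubeIndex_sub_mem_neighbours {k : Fin (n + 1)} {L ε : ℝ} (hε : 0 < ε)
    {x x' : EuclideanSpace ℝ (Fin (n + 1))} (h1 : ‖perp k (x' - x)‖ ≤ 2)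
    (h2 : |(x' - x) k| ≤ L + 2) : cubeIndex ε x' - cubeIndex ε x ∈ neighbours k L ε := by
  refine ⟨x' - x, h1, h2, fun i => ?_⟩
  have e : (x' - x) i - ε * ((cubeIndex ε x' - cubeIndex ε x) i : ℤ)
      = ε * (Int.fract (x' i / ε) - Int.fract (x i / ε)) := by
    simp only [PiLp.sub_apply, cubeIndex, Pi.sub_apply, Int.cast_sub, Int.fract]
    field_simp
    ring
  rw [e, abs_mul, abs_of_pos hε]
  have h3 : |Int.fract (x' i / ε) - Int.fract (x i / ε)| < 1 := by
    rw [abs_lt]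
    have := Int.fract_nonneg (x' i / ε)
    have := Int.fract_nonneg (x i / ε)
    have := Int.fract_lt_one (x' i / ε)
    have := Int.fract_lt_one (x i / ε)
    constructor <;> linarith
  nlinarith

/-- Each coordinate moves by at most `2 * ε`: one `ε` from the definition of `neighbours`, one from
the position inside the cube. The transverse norm then moves by at most `2 * ε * √n`, bounded
crudely by `2 * ε * (n + 1)`. -/
lemma cube_subset_of_mem_neighbours {k : Fin (n + 1)} {L ε : ℝ} (hε : 0 < ε)
    {z : Fin (n + 1) → ℤ} (hz : z ∈ neighbours k L ε) :
    cube ε z ⊆ {x | x k ∈ Icc (-(L + 2 + 2 * ε * (n + 1))) (L + 2 + 2 * ε * (n + 1)) ∧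
      perp k x ∈ Metric.closedBall 0 (2 + 2 * ε * (n + 1))} := by
  intro w hw
  obtain ⟨u, h1, h2, h3⟩ := hz
  have hwi : ∀ i, |(w - u) i| ≤ 2 * ε := by
    intro i
    rw [cube_eq_preimage hε] at hw
    have hi := (mem_univ_pi.1 hw) i
    have := h3 i
    rw [abs_lt] at this
    rw [PiLp.sub_apply, abs_le]
    have a1 := hi.1
    have a2 := hi.2
    constructor <;> linarith
  have hn : (0 : ℝ) ≤ n := n.cast_nonneg
  have hp : ‖perp k (w - u)‖ ≤ 2 * ε * (n + 1) := by
    refine abs_le_of_sq_le_sq' ?_ (by positivity) |>.2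
    rw [EuclideanSpace.norm_sq_eq]
    calc ∑ i, ‖perp k (w - u) i‖ ^ 2 ≤ ∑ _i : Fin n, (2 * ε) ^ 2 :=
          Finset.sum_le_sum fun i _ => pow_le_pow_left₀ (norm_nonneg _) (hwi _) 2
      _ = n * (2 * ε) ^ 2 := by simp
      _ ≤ (2 * ε * (n + 1)) ^ 2 := by
          rw [mul_pow _ ((n : ℝ) + 1), mul_comm]
          gcongr
          nlinarith
  constructor
  · have := hwi k
    rw [PiLp.sub_apply, abs_le] at this
    rw [abs_le] at h2
    have : 0 ≤ 2 * ε * n := by positivity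
    constructor <;> nlinarith
  · rw [mem_closedBall_zero_iff]
    have e : perp k w = perp k u + perp k (w - u) := by rw [perp_sub, add_sub_cancel]
    rw [e]
    exact (norm_add_le _ _).trans (add_le_add h1 hp)

/-- The left side is the total volume of disjoint cubes that fit in the enlarged cylinder. -/
lemma card_mul_le_of_subset_neighbours (hn : 0 < n) {k : Fin (n + 1)} {L ε : ℝ} (hL : 0 < L)
    (hε : 0 < ε) {F : Finset (Fin (n + 1) → ℤ)} (hF : ∀ z ∈ F, z ∈ neighbours k L ε) :
    (F.card : ℝ≥0∞) * ENNReal.ofReal ε ^ (n + 1) ≤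
      ENNReal.ofReal (2 * (L + 2 + 2 * ε * (n + 1)) *
        ((2 + 2 * ε * (n + 1)) ^ n * unitBallVolume n)) := by
  have h1 : (F.card : ℝ≥0∞) * ENNReal.ofReal ε ^ (n + 1) = volume (⋃ z ∈ F, cube ε z) := by
    rw [measure_biUnion_finset (fun z _ z' _ h => disjoint_cube ε h)
      (fun z _ => measurableSet_cube hε z)]
    simp [volume_cube hε]
  rw [h1]
  refine (measure_mono (iUnion₂_subset fun z hz =>
    cube_subset_of_mem_neighbours hε (hF z hz))).trans ?_
  rw [volume_coord_perp k measurableSet_Icc measurableSet_closedBall, Real.volume_Icc,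
    volume_closedBall_eq hn _ (by positivity), ← ENNReal.ofReal_mul (by
      have : 0 ≤ 2 * ε * ((n : ℝ) + 1) := by positivity
      linarith)]
  refine le_of_eq ?_
  congr 2
  ring

/-- A rigid stick process of small intensity does not percolate. -/
theorem ae_not_percolates (hn : 0 < n) {k : Fin (n + 1)} {p : Orientation (n + 1)}
    (hp : (p : EuclideanSpace ℝ (Fin (n + 1))) = EuclideanSpace.single k 1) {L lam : ℝ}
    (hL : 0 < L) (hlam : 0 < lam) (hsmall : lam * (2 * (L + 2) * (2 ^ n * unitBallVolume n)) < 1)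
    {Ω : Type} [MeasurableSpace Ω] {P : Measure Ω} [IsProbabilityMeasure P]
    {N : Ω → Config (n + 1)}
    (h : IsPoissonPointProcess (intensity (Measure.dirac p) lam) N P) :
    ∀ᵐ a ∂P, ¬ Percolates L (N a) := by
  -- The strict inequality `hsmall` is the case `ε = 0` and persists for small positive `ε` by
  -- continuity.
  obtain ⟨ε, hg, hε⟩ : ∃ ε : ℝ, lam * (2 * (L + 2 + 2 * ε * (n + 1)) *
      ((2 + 2 * ε * (n + 1)) ^ n * unitBallVolume n)) < 1 ∧ 0 < ε := by
    have hc : Continuous fun ε : ℝ => lam * (2 * (L + 2 + 2 * ε * (n + 1)) *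
      ((2 + 2 * ε * (n + 1)) ^ n * unitBallVolume n)) := by fun_prop
    have h0 := (hc.tendsto 0).eventually_lt_const (u := 1) (by simpa using hsmall)
    exact ((h0.filter_mono nhdsWithin_le_nhds).and
      (self_mem_nhdsWithin : Ioi (0 : ℝ) ∈ nhdsWithin 0 (Ioi 0))).exists
  set c := ENNReal.ofReal lam * ENNReal.ofReal ε ^ (n + 1) with hc
  have hc0 : c ≠ 0 := mul_ne_zero (by simpa using hlam) (pow_ne_zero _ (by simpa using hε))
  have hctop : c ≠ ∞ := ENNReal.mul_ne_top ENNReal.ofReal_ne_top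
    (ENNReal.pow_ne_top ENNReal.ofReal_ne_top)
  have hcard : ∀ F : Finset (Fin (n + 1) → ℤ), (∀ z ∈ F, z ∈ neighbours k L ε) →
      (F.card : ℝ≥0∞) * c < 1 := by
    intro F hF
    rw [hc, mul_left_comm]
    refine (mul_le_mul_right (card_mul_le_of_subset_neighbours hn hL hε hF) _).trans_lt ?_
    rw [← ENNReal.ofReal_mul hlam.le]
    exact ENNReal.ofReal_lt_one.2 hg
  -- The volume bound also gives finiteness: an infinite set would contain finite subsets of
  -- cardinality violating `hcard`.
  have hfin : (neighbours k L ε).Finite := by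
    by_contra hinf
    obtain ⟨m, hm⟩ := ENNReal.exists_nat_mul_gt hc0 ENNReal.one_ne_top
    obtain ⟨F, hF, rfl⟩ := Set.Infinite.exists_subset_card_eq hinf m
    exact lt_asymm hm (hcard F fun z hz => hF hz)
  set F := hfin.toFinset with hFdef
  have hFmem : ∀ {z}, z ∈ F ↔ z ∈ neighbours k L ε := hfin.mem_toFinset
  have hlt : (F.card : ℝ≥0∞) * c < 1 := hcard F fun z hz => hFmem.1 hz
  have hz : ∀ z, ∀ᵐ a ∂P, ∃ m, ¬ HasPath (occupiedCubes ε (N a)) F z m := by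
    intro z
    rw [ae_iff]
    have hle : ∀ m : ℕ, P {a | ¬ ∃ m, ¬ HasPath (occupiedCubes ε (N a)) F z m} ≤
        ((F.card : ℝ≥0∞) * c) ^ m * c := by
      intro m
      refine (measure_mono fun a ha => ?_).trans ((measure_hasPath_le h hε F z m).trans ?_)
      · by_contra hm
        exact ha ⟨m, hm⟩
      · rw [← hc, mul_pow _ c, pow_succ c, mul_assoc]
    have ht : Filter.Tendsto (fun m : ℕ => ((F.card : ℝ≥0∞) * c) ^ m * c) Filter.atTop
        (nhds 0) := by
      have := ENNReal.Tendsto.mul_const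
        (ENNReal.tendsto_pow_atTop_nhds_zero_of_lt_one hlt) (b := c) (Or.inr hctop)
      rwa [zero_mul] at this
    exact le_antisymm (ge_of_tendsto' ht hle) zero_le
  filter_upwards [ae_all_iff.2 hz, h.ae_orientation_eq] with a ha hpa
  refine not_percolates_of_finite_clusters hL hε (F := F) (fun q hq q' hq' hmeet => ?_)
    fun z₀ hz₀ => ?_
  · rw [hpa q hq, hpa q' hq'] at hmeet
    obtain ⟨h1, h2⟩ := sub_bounds_of_sticks_meet hL hp hmeet
    exact hFmem.2 (cubeIndex_sub_mem_neighbours hε h1 h2)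
  · obtain ⟨m, hm⟩ := ha z₀
    exact exists_finite_cluster (hFmem.2 (zero_mem_neighbours hL hε))
      (fun f hf => hFmem.2 (neg_mem_neighbours (hFmem.1 hf))) hz₀ hm

end Subcritical

/-! ### Renormalisation of a planar array by blocks of nine -/

section Blocks

/-- The `u`-th of the nine subblocks of the block `w`. -/
def subblock (w : ℕ × ℕ) (u : Fin 3 × Fin 3) : ℕ × ℕ := (3 * w.1 + u.1, 3 * w.2 + u.2)

lemma subblock_injective : Function.Injective fun p : (ℕ × ℕ) × (Fin 3 × Fin 3) =>
    subblock p.1 p.2 := by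
  rintro ⟨⟨a, b⟩, ⟨⟨u, hu⟩, ⟨v, hv⟩⟩⟩ ⟨⟨a', b'⟩, ⟨⟨u', hu'⟩, ⟨v', hv'⟩⟩⟩ h
  simp only [subblock, Prod.mk.injEq] at h
  simp only [Prod.mk.injEq, Fin.mk.injEq]
  omega

/-- Badness of the blocks of level `m`: at level `0` the bad blocks are the elements of `B`, and a
block of level `m + 1` is bad if at least two of its subblocks are bad. -/
def Bad (B : Set (ℕ × ℕ)) : ℕ → ℕ × ℕ → Prop
  | 0, w => w ∈ B
  | m + 1, w => ∃ u v, u ≠ v ∧ Bad B m (subblock w u) ∧ Bad B m (subblock w v)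

lemma card_distinct_pairs :
    Fintype.card {p : (Fin 3 × Fin 3) × (Fin 3 × Fin 3) // p.1 ≠ p.2} = 72 := by
  rw [Fintype.card_subtype]
  decide

/-- A bad block of the next level has an ordered pair of distinct bad subblocks, one of `9 * 8 = 72`
choices, so the bound `q_m` becomes `72 * q_m ^ 2 ≤ q_m / 2`. Stating it for all finite families `W`
makes the induction close without any independence: badness of `W` is turned into badness of a
family of twice the size. -/
lemma measure_forall_bad_le {Ω : Type*} [MeasurableSpace Ω] {P : Measure Ω}
    {B : Ω → Set (ℕ × ℕ)} {q : ℝ≥0∞} (hq : 72 * q ≤ 2⁻¹)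
    (hB : ∀ W : Finset (ℕ × ℕ), P {a | ∀ w ∈ W, w ∈ B a} ≤ q ^ W.card) (m : ℕ)
    (W : Finset (ℕ × ℕ)) : P {a | ∀ w ∈ W, Bad (B a) m w} ≤ (q * 2⁻¹ ^ m) ^ W.card := by
  classical
  induction m generalizing W with
  | zero => simpa [Bad] using hB W
  | succ m ih =>
    let D := {p : (Fin 3 × Fin 3) × (Fin 3 × Fin 3) // p.1 ≠ p.2}
    -- Given a choice of pairs, `g f` lists the two chosen subblocks of every block of `W`; these `2
    -- * W.card` subblocks are distinct.
    let g : (W → D) → W × Bool → ℕ × ℕ := fun f x =>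
      subblock x.1 (cond x.2 (f x.1).1.1 (f x.1).1.2)
    have hg : ∀ f, Function.Injective (g f) := by
      rintro f ⟨w, b⟩ ⟨w', b'⟩ h
      have h1 := @subblock_injective (w, _) (w', _) h
      simp only [Prod.mk.injEq, Subtype.coe_inj] at h1
      obtain ⟨rfl, h2⟩ := h1
      have hne := (f w).2
      cases b <;> cases b'
      · rfl
      · exact absurd h2.symm hne
      · exact absurd h2 hne
      · rfl
    have hsub : {a | ∀ w ∈ W, Bad (B a) (m + 1) w} ⊆
        ⋃ f : W → D, {a | ∀ w ∈ Finset.univ.image (g f), Bad (B a) m w} := by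
      intro a ha
      have : ∀ w : W, ∃ p : D, Bad (B a) m (subblock w p.1.1) ∧ Bad (B a) m (subblock w p.1.2) := by
        intro w
        obtain ⟨u, v, huv, h1, h2⟩ := ha w w.2
        exact ⟨⟨(u, v), huv⟩, h1, h2⟩
      choose f hf1 hf2 using this
      refine mem_iUnion.2 ⟨f, ?_⟩
      intro w hw
      obtain ⟨⟨w', b⟩, -, rfl⟩ := Finset.mem_image.1 hw
      cases b
      · simpa [g] using hf2 w'
      · simpa [g] using hf1 w'
    refine (measure_mono hsub).trans ((measure_iUnion_fintype_le _ _).trans ?_)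
    have hcard : ∀ f, (Finset.univ.image (g f)).card = 2 * W.card := by
      intro f
      rw [Finset.card_image_of_injective _ (hg f)]
      simp [mul_comm]
    calc ∑ f : W → D, P {a | ∀ w ∈ Finset.univ.image (g f), Bad (B a) m w}
        ≤ ∑ _f : W → D, (q * 2⁻¹ ^ m) ^ (2 * W.card) :=
          Finset.sum_le_sum fun f _ => hcard f ▸ ih _
      _ = (72 * (q * 2⁻¹ ^ m) ^ 2) ^ W.card := by
          rw [Finset.sum_const, Finset.card_univ, Fintype.card_fun, card_distinct_pairs,
            Fintype.card_coe, nsmul_eq_mul, mul_pow (72 : ℝ≥0∞), ← pow_mul, Nat.cast_pow]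
          norm_num
      _ ≤ (q * 2⁻¹ ^ (m + 1)) ^ W.card := by
          refine pow_le_pow_left' ?_ _
          have h1 : q * 2⁻¹ ^ m ≤ q := by
            refine mul_le_of_le_one_right' ?_
            exact pow_le_one' (ENNReal.inv_le_one.2 one_le_two) m
          calc 72 * (q * 2⁻¹ ^ m) ^ 2 = 72 * (q * 2⁻¹ ^ m) * (q * 2⁻¹ ^ m) := by ring
            _ ≤ 72 * q * (q * 2⁻¹ ^ m) := by gcongr
            _ ≤ 2⁻¹ * (q * 2⁻¹ ^ m) := by gcongr
            _ = q * 2⁻¹ ^ (m + 1) := by ring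

/-- Borel–Cantelli, since the probabilities are bounded by a geometric series. -/
lemma ae_eventually_not_bad {Ω : Type*} [MeasurableSpace Ω] {P : Measure Ω}
    {B : Ω → Set (ℕ × ℕ)} {q : ℝ≥0∞} (hq : 72 * q ≤ 2⁻¹)
    (hB : ∀ W : Finset (ℕ × ℕ), P {a | ∀ w ∈ W, w ∈ B a} ≤ q ^ W.card) (w : ℕ × ℕ) :
    ∀ᵐ a ∂P, ∃ m₀, ∀ m ≥ m₀, ¬ Bad (B a) m w := by
  have hle : ∀ m, P {a | Bad (B a) m w} ≤ q * 2⁻¹ ^ m := fun m => by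
    simpa using measure_forall_bad_le hq hB m {w}
  have hqf : q ≠ ∞ := by
    rintro rfl
    rw [ENNReal.mul_top (by norm_num)] at hq
    exact absurd hq (by simp)
  have hs : ∑' m, P {a | Bad (B a) m w} ≠ ∞ := by
    refine ne_top_of_le_ne_top ?_ (ENNReal.tsum_le_tsum hle)
    rw [ENNReal.tsum_mul_left, ENNReal.tsum_geometric, ENNReal.one_sub_inv_two, inv_inv]
    exact ENNReal.mul_ne_top hqf (by simp)
  filter_upwards [ae_eventually_notMem hs] with a ha
  exact Filter.eventually_atTop.1 ha

lemma reflTransGen_fin_three {R : Fin 3 → Fin 3 → Prop} (hs : ∀ a b, R a b → R b a)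
    (h1 : R 0 1) (h2 : R 1 2) (a b : Fin 3) : Relation.ReflTransGen R a b := by
  have h : ∀ a, Relation.ReflTransGen R 1 a := by
    intro a
    fin_cases a
    · exact .single (hs _ _ h1)
    · exact .refl
    · exact .single h2
  have : Std.Symm R := ⟨hs⟩
  exact (symm (h a)).trans (h b)

/-- The `3 × 3` grid remains connected when at most one vertex is deleted. -/
lemma reflTransGen_grid {G : Fin 3 × Fin 3 → Prop} (hG : ∀ u v, u ≠ v → G u ∨ G v)
    {R : Fin 3 × Fin 3 → Fin 3 × Fin 3 → Prop} (hs : ∀ u v, R u v → R v u)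
    (hR1 : ∀ c (a b : Fin 3), (b : ℕ) = a + 1 → G (a, c) → G (b, c) → R (a, c) (b, c))
    (hR2 : ∀ c (a b : Fin 3), (b : ℕ) = a + 1 → G (c, a) → G (c, b) → R (c, a) (c, b))
    {u v : Fin 3 × Fin 3} (hu : G u) (hv : G v) : Relation.ReflTransGen R u v := by
  -- `b` is the deleted vertex; if none is deleted, any third vertex serves.
  obtain ⟨b, hbu, hbv, hb⟩ : ∃ b, b ≠ u ∧ b ≠ v ∧ ∀ w, w ≠ b → G w := by
    by_cases h : ∃ b, ¬ G b
    · obtain ⟨b, hb⟩ := h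
      refine ⟨b, ?_, ?_, fun w hw => (hG w b hw).resolve_right hb⟩
      · rintro rfl; exact hb hu
      · rintro rfl; exact hb hv
    · push Not at h
      have : ∀ u v : Fin 3 × Fin 3, ∃ b, b ≠ u ∧ b ≠ v := by decide
      obtain ⟨b, h1, h2⟩ := this u v
      exact ⟨b, h1, h2, fun w _ => h w⟩
  have hline1 : ∀ y, y ≠ b.2 → ∀ x x', Relation.ReflTransGen R (x, y) (x', y) := by
    intro y hy x x'
    have hg : ∀ x, G (x, y) := fun x => hb _ fun h => hy (congrArg Prod.snd h)
    exact Relation.ReflTransGen.lift (fun x => (x, y)) (fun _ _ h => h) _ _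
      (reflTransGen_fin_three (R := fun x x' => R (x, y) (x', y)) (fun _ _ => hs _ _)
        (hR1 y 0 1 rfl (hg _) (hg _)) (hR1 y 1 2 rfl (hg _) (hg _)) x x')
  have hline2 : ∀ x, x ≠ b.1 → ∀ y y', Relation.ReflTransGen R (x, y) (x, y') := by
    intro x hx y y'
    have hg : ∀ y, G (x, y) := fun y => hb _ fun h => hx (congrArg Prod.fst h)
    exact Relation.ReflTransGen.lift (fun y => (x, y)) (fun _ _ h => h) _ _
      (reflTransGen_fin_three (R := fun y y' => R (x, y) (x, y')) (fun _ _ => hs _ _)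
        (hR2 x 0 1 rfl (hg _) (hg _)) (hR2 x 1 2 rfl (hg _) (hg _)) y y')
  -- A full column `c` and a full row `r` avoid `b`. Every other vertex reaches their crossing along
  -- its own row or its own column, at least one of which avoids `b`.
  obtain ⟨c, hc⟩ : ∃ c, c ≠ b.1 := exists_ne _
  obtain ⟨r, hr⟩ : ∃ r, r ≠ b.2 := exists_ne _
  have hcentre : ∀ w, w ≠ b → Relation.ReflTransGen R w (c, r) := by
    rintro ⟨x, y⟩ hw
    by_cases hx : x = b.1
    · have hy : y ≠ b.2 := fun hy => hw (Prod.ext hx hy)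
      exact (hline1 y hy x c).trans (hline2 c hc y r)
    · exact (hline2 x hx y r).trans (hline1 r hr x c)
  have : Std.Symm R := ⟨hs⟩
  exact (hcentre u hbu.symm).trans (symm (hcentre v hbv.symm))

variable {E : Type*}

/-- The union of the sets of the cells reached from the block `w` through good subblocks. -/
def blockUnion (B : Set (ℕ × ℕ)) (C : ℕ × ℕ → Set E) : ℕ → ℕ × ℕ → Set E
  | 0, w => C w
  | m + 1, w => ⋃ u ∈ {u | ¬ Bad B m (subblock w u)}, blockUnion B C m (subblock w u)

lemma blockUnion_subset {B : Set (ℕ × ℕ)} {C : ℕ × ℕ → Set E} {m : ℕ} {w : ℕ × ℕ}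
    (hw : ¬ Bad B m w) : blockUnion B C m w ⊆ ⋃ w ∈ Bᶜ, C w := by
  induction m generalizing w with
  | zero => exact subset_biUnion_of_mem (u := C) (show w ∈ Bᶜ from hw)
  | succ m ih => exact iUnion₂_subset fun u hu => ih hu

/-- Descending through good subblocks ends at a good cell. The bound on the second coordinate later
shows that clusters reach far away. -/
lemma exists_cell_subset_blockUnion {B : Set (ℕ × ℕ)} {C : ℕ × ℕ → Set E} {m : ℕ} {w : ℕ × ℕ}
    (hw : ¬ Bad B m w) : ∃ w₀ ∉ B, 3 ^ m * w.2 ≤ w₀.2 ∧ C w₀ ⊆ blockUnion B C m w := by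
  induction m generalizing w with
  | zero => exact ⟨w, hw, by simp, Subset.rfl⟩
  | succ m ih =>
    have : ∃ u, ¬ Bad B m (subblock w u) := by
      by_contra h
      push Not at h
      exact hw ⟨(0, 0), (0, 1), by decide, h _, h _⟩
    obtain ⟨u, hu⟩ := this
    obtain ⟨w₀, h1, h2, h3⟩ := ih hu
    refine ⟨w₀, h1, le_trans ?_ h2, h3.trans ?_⟩
    · simp only [subblock, pow_succ]
      nlinarith [Nat.zero_le (3 ^ m * (u.2 : ℕ))]
    · exact subset_biUnion_of_mem (u := fun u => blockUnion B C m (subblock w u)) hu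

variable [TopologicalSpace E]

/-- Connectedness and the meeting of adjacent good blocks are proved together by induction. Inside a
good block at most one of the nine subblocks is bad, and the grid minus one vertex is connected. Two
adjacent good blocks face each other along three pairs of subblocks; at most two pairs are spoiled,
so one pair is good on both sides. -/
lemma blockUnion_connected {B : Set (ℕ × ℕ)} {C : ℕ × ℕ → Set E}
    (hC : ∀ w ∉ B, IsPreconnected (C w))
    (h1 : ∀ w ∉ B, ∀ w' ∉ B, w' = (w.1 + 1, w.2) → (C w ∩ C w').Nonempty)
    (h2 : ∀ w ∉ B, ∀ w' ∉ B, w' = (w.1, w.2 + 1) → (C w ∩ C w').Nonempty) (m : ℕ) :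
    (∀ w, ¬ Bad B m w → IsPreconnected (blockUnion B C m w)) ∧
    (∀ w w', ¬ Bad B m w → ¬ Bad B m w' → w' = (w.1 + 1, w.2) →
      (blockUnion B C m w ∩ blockUnion B C m w').Nonempty) ∧
    (∀ w w', ¬ Bad B m w → ¬ Bad B m w' → w' = (w.1, w.2 + 1) →
      (blockUnion B C m w ∩ blockUnion B C m w').Nonempty) := by
  induction m with
  | zero => exact ⟨hC, fun w w' h h' => h1 w h w' h', fun w w' h h' => h2 w h w' h'⟩
  | succ m ih =>
    obtain ⟨ih0, ih1, ih2⟩ := ih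
    have two : ∀ {w}, ¬ Bad B (m + 1) w → ∀ u v, u ≠ v →
        ¬ Bad B m (subblock w u) ∨ ¬ Bad B m (subblock w v) := by
      intro w hw u v huv
      by_contra h
      push Not at h
      exact hw ⟨u, v, huv, h⟩
    have three : ∀ {w w'}, ¬ Bad B (m + 1) w → ¬ Bad B (m + 1) w' →
        ∀ f g : Fin 3 → Fin 3 × Fin 3, Function.Injective f → Function.Injective g →
        ∃ i, ¬ Bad B m (subblock w (f i)) ∧ ¬ Bad B m (subblock w' (g i)) := by
      intro w w' hw hw' f g hf hg
      have a := fun i j hij => two hw (f i) (f j) (hf.ne hij)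
      have b := fun i j hij => two hw' (g i) (g j) (hg.ne hij)
      have a01 := a 0 1 (by decide)
      have a02 := a 0 2 (by decide)
      have a12 := a 1 2 (by decide)
      have b01 := b 0 1 (by decide)
      have b02 := b 0 2 (by decide)
      have b12 := b 1 2 (by decide)
      by_contra h
      push Not at h
      have c0 := h 0
      have c1 := h 1
      have c2 := h 2
      tauto
    have mono : ∀ {w u}, ¬ Bad B m (subblock w u) →
        blockUnion B C m (subblock w u) ⊆ blockUnion B C (m + 1) w := fun {w u} hu =>
      subset_biUnion_of_mem (u := fun u => blockUnion B C m (subblock w u)) hu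
    refine ⟨fun w hw => ?_, fun w w' hw hw' e => ?_, fun w w' hw hw' e => ?_⟩
    · refine IsPreconnected.biUnion_of_reflTransGen (fun u hu => ih0 _ hu) fun u hu v hv => ?_
      have key := reflTransGen_grid (G := fun u => ¬ Bad B m (subblock w u)) (two hw)
        (R := fun u v => (blockUnion B C m (subblock w u) ∩
          blockUnion B C m (subblock w v)).Nonempty ∧
          ¬ Bad B m (subblock w u) ∧ ¬ Bad B m (subblock w v))
        (fun u v h => ⟨by rw [inter_comm]; exact h.1, h.2.2, h.2.1⟩)
        (fun c a b hab ha hb => ⟨ih1 _ _ ha hb (by simp [subblock, hab]; omega), ha, hb⟩)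
        (fun c a b hab ha hb => ⟨ih2 _ _ ha hb (by simp [subblock, hab]; omega), ha, hb⟩) hu hv
      exact Relation.ReflTransGen.mono (fun u v h => ⟨h.1, h.2.1⟩) _ _ key
    · obtain ⟨i, hi, hi'⟩ := three hw hw' (fun i => (2, i)) (fun i => (0, i))
        (fun i j h => (Prod.mk.inj h).2) (fun i j h => (Prod.mk.inj h).2)
      exact (ih1 _ _ hi hi' (by subst e; simp [subblock]; omega)).mono
        (inter_subset_inter (mono hi) (mono hi'))
    · obtain ⟨i, hi, hi'⟩ := three hw hw' (fun i => (i, 2)) (fun i => (i, 0))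
        (fun i j h => (Prod.mk.inj h).1) (fun i j h => (Prod.mk.inj h).1)
      exact (ih2 _ _ hi hi' (by subst e; simp [subblock]; omega)).mono
        (inter_subset_inter (mono hi) (mono hi'))

/-- If the blocks at the origin are eventually good, then there is a connected union of good cells
that contains cells arbitrarily far away. -/
lemma exists_preconnected_of_eventually_not_bad {B : Set (ℕ × ℕ)} {C : ℕ × ℕ → Set E}
    (hC : ∀ w ∉ B, IsPreconnected (C w)) (hne : ∀ w ∉ B, (C w).Nonempty)
    (h1 : ∀ w ∉ B, ∀ w' ∉ B, w' = (w.1 + 1, w.2) → (C w ∩ C w').Nonempty)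
    (h2 : ∀ w ∉ B, ∀ w' ∉ B, w' = (w.1, w.2 + 1) → (C w ∩ C w').Nonempty)
    {m₀ : ℕ} (hm : ∀ m ≥ m₀, ¬ Bad B m (0, 0)) :
    ∃ U : Set E, IsPreconnected U ∧ U ⊆ ⋃ w ∈ Bᶜ, C w ∧
      ∀ M : ℕ, ∃ w ∉ B, M ≤ w.2 ∧ C w ⊆ U := by
  have hgood : ∀ i, ¬ Bad B (m₀ + i) (0, 0) := fun i => hm _ (Nat.le_add_right _ _)
  -- The subblock `(0, 0)` of the block `(0, 0)` again has index `(0, 0)`, so the unions at the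
  -- origin are nested.
  have hmono : Monotone fun i => blockUnion B C (m₀ + i) (0, 0) := by
    refine monotone_nat_of_le_succ fun i => ?_
    exact subset_biUnion_of_mem (u := fun u => blockUnion B C (m₀ + i) (subblock (0, 0) u))
      (show (0, 0) ∈ {u | ¬ Bad B (m₀ + i) (subblock (0, 0) u)} from hgood i)
  obtain ⟨w, hw, -, hwC⟩ := exists_cell_subset_blockUnion (C := C) (hgood 0)
  obtain ⟨x, hx⟩ := hne w hw
  refine ⟨⋃ i, blockUnion B C (m₀ + i) (0, 0), ?_, iUnion_subset fun i =>
    blockUnion_subset (hgood i), fun M => ?_⟩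
  · exact isPreconnected_iUnion ⟨x, mem_iInter.2 fun i => hmono (Nat.zero_le i) (hwC hx)⟩
      fun i => (blockUnion_connected hC h1 h2 _).1 _ (hgood i)
  · have hex : ∃ i : Fin 3, i ≠ 0 ∧ ¬ Bad B (m₀ + M) (subblock (0, 0) (0, i)) := by
      by_contra h
      push Not at h
      exact hgood (M + 1) ⟨(0, 1), (0, 2), by decide, h 1 (by decide), h 2 (by decide)⟩
    obtain ⟨i, hi0, hi⟩ := hex
    obtain ⟨w, hw, hwM, hwC⟩ := exists_cell_subset_blockUnion (C := C) hi
    refine ⟨w, hw, le_trans ?_ hwM, hwC.trans ((subset_biUnion_of_mem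
      (u := fun u => blockUnion B C (m₀ + M) (subblock (0, 0) u)) hi).trans
      (subset_iUnion (fun i => blockUnion B C (m₀ + i) (0, 0)) (M + 1)))⟩
    have h3 : M < 3 ^ (m₀ + M) := (Nat.le_add_left M m₀).trans_lt (Nat.lt_pow_self (by norm_num))
    have h4 : 1 ≤ (i : ℕ) := Nat.one_le_iff_ne_zero.2 fun h => hi0 (Fin.ext h)
    simp only [subblock]
    nlinarith

end Blocks

/-! ### Percolation at large intensity -/

section Supercritical

variable {n : ℕ}

/-- The cells of a planar array of cylinders such that any two sticks along the `k`-th axis which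
are centred in cells at distance at most one in the array intersect. -/
def cell (hn : 0 < n) (k : Fin (n + 1)) (L : ℝ) (w : ℕ × ℕ) :
    Set (EuclideanSpace ℝ (Fin (n + 1))) :=
  {x | x k ∈ Ico (w.2 * (L / 2)) ((w.2 + 1) * (L / 2)) ∧
    perp k x ∈ Metric.ball (EuclideanSpace.single ⟨0, hn⟩ (w.1 : ℝ)) (1 / 2)}

lemma measurableSet_cell (hn : 0 < n) (k : Fin (n + 1)) (L : ℝ) (w : ℕ × ℕ) :
    MeasurableSet (cell hn k L w) :=
  (measurePreserving_coord_perp k).measurable (measurableSet_Ico.prod measurableSet_ball)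

lemma volume_cell (hn : 0 < n) (k : Fin (n + 1)) {L : ℝ} (hL : 0 < L) (w : ℕ × ℕ) :
    volume (cell hn k L w) = ENNReal.ofReal (L / 2 * ((1 / 2) ^ n * unitBallVolume n)) := by
  have : Nonempty (Fin n) := ⟨⟨0, hn⟩⟩
  rw [cell, volume_coord_perp k measurableSet_Ico measurableSet_ball, Real.volume_Ico,
    ← Measure.addHaar_closedBall_eq_addHaar_ball, volume_closedBall_eq hn _ (by norm_num),
    ← ENNReal.ofReal_mul (by linarith)]
  congr 2
  ring

lemma disjoint_cell (hn : 0 < n) (k : Fin (n + 1)) {L : ℝ} (hL : 0 < L) {w w' : ℕ × ℕ}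
    (h : w ≠ w') : Disjoint (cell hn k L w) (cell hn k L w') := by
  refine Set.disjoint_left.2 fun x hx hx' => h ?_
  obtain ⟨⟨h1, h2⟩, h3⟩ := hx
  obtain ⟨⟨h1', h2'⟩, h3'⟩ := hx'
  have hL2 : 0 < L / 2 := by linarith
  refine Prod.ext ?_ ?_
  · have hd := dist_triangle_left (EuclideanSpace.single (⟨0, hn⟩ : Fin n) (w.1 : ℝ))
      (EuclideanSpace.single (⟨0, hn⟩ : Fin n) (w'.1 : ℝ)) (perp k x)
    rw [PiLp.dist_single_same, Real.dist_eq] at hd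
    have hlt : |(w.1 : ℝ) - w'.1| < 1 := by
      rw [Metric.mem_ball] at h3 h3'
      linarith
    have hz : |((w.1 : ℤ) - w'.1)| < 1 := by exact_mod_cast hlt
    have := Int.abs_lt_one_iff.1 hz
    omega
  · have a1 := lt_of_mul_lt_mul_right (h1.trans_lt h2') hL2.le
    have a2 := lt_of_mul_lt_mul_right (h1'.trans_lt h2) hL2.le
    norm_cast at a1 a2
    omega

/-- Across the axis the centres are less than `1/2 + 1 + 1/2 = 2` apart, and along it less than two
cell lengths, that is `L`. -/
lemma sticks_meet_of_mem_cell (hn : 0 < n) {k : Fin (n + 1)} {L : ℝ} (hL : 0 < L)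
    {p : Orientation (n + 1)}
    (hp : (p : EuclideanSpace ℝ (Fin (n + 1))) = EuclideanSpace.single k 1) {w w' : ℕ × ℕ}
    (h1 : w'.1 = w.1 ∨ w'.1 = w.1 + 1) (h2 : w'.2 = w.2 ∨ w'.2 = w.2 + 1)
    {x x' : EuclideanSpace ℝ (Fin (n + 1))} (hx : x ∈ cell hn k L w) (hx' : x' ∈ cell hn k L w') :
    (stick L x p ∩ stick L x' p).Nonempty := by
  obtain ⟨⟨h3, h4⟩, h5⟩ := hx
  obtain ⟨⟨h3', h4'⟩, h5'⟩ := hx'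
  have hL2 : 0 < L / 2 := by linarith
  refine sticks_meet hL hp ?_ ?_
  · rw [Metric.mem_ball] at h5 h5'
    rw [perp_sub, ← dist_eq_norm]
    have hd := dist_triangle4 (perp k x') (EuclideanSpace.single (⟨0, hn⟩ : Fin n) (w'.1 : ℝ))
      (EuclideanSpace.single (⟨0, hn⟩ : Fin n) (w.1 : ℝ)) (perp k x)
    rw [PiLp.dist_single_same, dist_comm (EuclideanSpace.single _ (w.1 : ℝ)) (perp k x)] at hd
    have : dist (w'.1 : ℝ) (w.1 : ℝ) ≤ 1 := by
      rcases h1 with h1 | h1 <;> simp [h1]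
    linarith
  · rw [PiLp.sub_apply, abs_le]
    have : (w'.2 : ℝ) = w.2 ∨ (w'.2 : ℝ) = w.2 + 1 := by exact_mod_cast h2
    rcases this with h | h <;> rw [h] at h3' h4' <;> constructor <;> nlinarith

lemma percolates_of_eventually_not_bad (hn : 0 < n) {k : Fin (n + 1)} {L : ℝ} (hL : 0 < L)
    {p : Orientation (n + 1)}
    (hp : (p : EuclideanSpace ℝ (Fin (n + 1))) = EuclideanSpace.single k 1) {ω : Config (n + 1)}
    (hω : ∀ q ∈ ω.1, q.2 = p) {m₀ : ℕ}
    (hm : ∀ m ≥ m₀, ¬ Bad {w | count (cell hn k L w ×ˢ univ) ω = 0} m (0, 0)) :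
    Percolates L ω := by
  set B : Set (ℕ × ℕ) := {w | count (cell hn k L w ×ˢ univ) ω = 0} with hB
  let S : ℕ × ℕ → Set (EuclideanSpace ℝ (Fin (n + 1)) × Orientation (n + 1)) :=
    fun w => {q ∈ ω.1 | q.1 ∈ cell hn k L w}
  let C : ℕ × ℕ → Set (EuclideanSpace ℝ (Fin (n + 1))) := fun w => ⋃ q ∈ S w, stick L q.1 q.2
  have hpt : ∀ w ∉ B, ∃ q, q ∈ S w := by
    intro w hw
    have hw' : ¬ count (cell hn k L w ×ˢ univ) ω = 0 := hw
    rw [count_eq_zero_iff] at hw'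
    push Not at hw'
    obtain ⟨q, hq, hqc⟩ := hw'
    exact ⟨q, hq, hqc.1⟩
  have hmeet : ∀ {w w' : ℕ × ℕ}, (w'.1 = w.1 ∨ w'.1 = w.1 + 1) →
      (w'.2 = w.2 ∨ w'.2 = w.2 + 1) → ∀ q ∈ S w, ∀ q' ∈ S w',
      (stick L q.1 q.2 ∩ stick L q'.1 q'.2).Nonempty := by
    intro w w' h1 h2 q hq q' hq'
    rw [hω q hq.1, hω q' hq'.1]
    exact sticks_meet_of_mem_cell hn hL hp h1 h2 hq.2 hq'.2
  have hadj : ∀ w ∉ B, ∀ w' ∉ B, (w'.1 = w.1 ∨ w'.1 = w.1 + 1) →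
      (w'.2 = w.2 ∨ w'.2 = w.2 + 1) → (C w ∩ C w').Nonempty := by
    intro w hw w' hw' h1 h2
    obtain ⟨q, hq⟩ := hpt w hw
    obtain ⟨q', hq'⟩ := hpt w' hw'
    exact (hmeet h1 h2 q hq q' hq').mono (inter_subset_inter
      (subset_biUnion_of_mem (u := fun q : EuclideanSpace ℝ (Fin (n + 1)) × Orientation (n + 1) =>
        stick L q.1 q.2) hq)
      (subset_biUnion_of_mem (u := fun q : EuclideanSpace ℝ (Fin (n + 1)) × Orientation (n + 1) =>
        stick L q.1 q.2) hq'))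
  obtain ⟨U, hU, hUC, hUM⟩ := exists_preconnected_of_eventually_not_bad (B := B) (C := C)
    (fun w _ => IsPreconnected.biUnion_of_reflTransGen
      (fun q _ => isPreconnected_stick hL q.1 q.2)
      fun q hq q' hq' => .single ⟨hmeet (Or.inl rfl) (Or.inl rfl) q hq q' hq', hq⟩)
    (fun w hw => by
      obtain ⟨q, hq⟩ := hpt w hw
      exact ⟨q.1, mem_iUnion₂.2 ⟨q, hq, self_mem_stick hL q.1 q.2⟩⟩)
    (fun w hw w' hw' e => hadj w hw w' hw' (Or.inr (by rw [e])) (Or.inl (by rw [e])))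
    (fun w hw w' hw' e => hadj w hw w' hw' (Or.inl (by rw [e])) (Or.inr (by rw [e]))) hm
  have hfar : ∀ M : ℕ, ∃ x ∈ U, M * (L / 2) ≤ x k := by
    intro M
    obtain ⟨w, hw, hMw, hwU⟩ := hUM M
    obtain ⟨q, hq⟩ := hpt w hw
    refine ⟨q.1, hwU (mem_iUnion₂.2 ⟨q, hq, self_mem_stick hL q.1 q.2⟩), le_trans ?_ hq.2.1.1⟩
    gcongr
  have hUocc : U ⊆ occupied L ω := by
    refine hUC.trans (iUnion₂_subset fun w _ => iUnion₂_subset fun q hq => ?_)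
    exact subset_biUnion_of_mem (u := fun q : EuclideanSpace ℝ (Fin (n + 1)) ×
      Orientation (n + 1) => stick L q.1 q.2) hq.1
  obtain ⟨x₀, hx₀, -⟩ := hfar 0
  refine ⟨x₀, hUocc hx₀, fun hb => ?_⟩
  obtain ⟨R, hR⟩ := (hb.subset (hU.subset_connectedComponentIn hx₀ hUocc)).exists_norm_le
  obtain ⟨M, hM⟩ := exists_nat_gt (R / (L / 2))
  obtain ⟨x, hx, hMx⟩ := hfar M
  rw [div_lt_iff₀ (by linarith)] at hM
  have h1 := hR x hx
  have h2 := (le_abs_self _).trans (abs_apply_le_norm k x)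
  linarith

/-- A rigid stick process of large intensity percolates. -/
theorem ae_percolates (hn : 0 < n) {k : Fin (n + 1)} {p : Orientation (n + 1)}
    (hp : (p : EuclideanSpace ℝ (Fin (n + 1))) = EuclideanSpace.single k 1) {L lam : ℝ}
    (hL : 0 < L) (hlam : 0 < lam)
    (hlarge : 7 ≤ lam * (L / 2 * ((1 / 2) ^ n * unitBallVolume n)))
    {Ω : Type} [MeasurableSpace Ω] {P : Measure Ω} [IsProbabilityMeasure P]
    {N : Ω → Config (n + 1)}
    (h : IsPoissonPointProcess (intensity (Measure.dirac p) lam) N P) :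
    ∀ᵐ a ∂P, Percolates L (N a) := by
  set v := lam * (L / 2 * ((1 / 2) ^ n * unitBallVolume n)) with hv
  have hB : ∀ W : Finset (ℕ × ℕ),
      P {a | ∀ w ∈ W, w ∈ {w | count (cell hn k L w ×ˢ univ) (N a) = 0}} ≤
        ENNReal.ofReal (Real.exp (-v)) ^ W.card := by
    intro W
    -- If all cells of `W` are empty then so is their union, whose void probability is the
    -- exponential of minus its total intensity `W.card * v`.
    set A : Set (EuclideanSpace ℝ (Fin (n + 1))) := ⋃ w ∈ W, cell hn k L w with hA
    have hAm : MeasurableSet A := W.measurableSet_biUnion fun w _ => measurableSet_cell hn k L w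
    have hAv : intensity (Measure.dirac p) lam (A ×ˢ (univ : Set (Orientation (n + 1))))
        = ENNReal.ofReal (W.card * v) := by
      rw [intensity_dirac_prod_univ p lam hAm, hA,
        measure_biUnion_finset (fun w _ w' _ hne => disjoint_cell hn k hL hne)
        (fun w _ => measurableSet_cell hn k L w)]
      simp only [volume_cell hn k hL, Finset.sum_const, nsmul_eq_mul]
      rw [← ENNReal.ofReal_natCast, ← ENNReal.ofReal_mul (by positivity),
        ← ENNReal.ofReal_mul hlam.le, hv]
      congr 1
      ring
    have e : {a | ∀ w ∈ W, w ∈ {w | count (cell hn k L w ×ˢ univ) (N a) = 0}}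
        ⊆ {a | count (A ×ˢ univ) (N a) = 0} := by
      intro a ha
      refine count_eq_zero_iff.2 fun q hq hqA => ?_
      obtain ⟨w, hw, hqw⟩ := mem_iUnion₂.1 hqA.1
      exact count_eq_zero_iff.1 (ha w hw) q hq ⟨hqw, trivial⟩
    refine (measure_mono e).trans ?_
    rw [h.measure_count_eq_zero (hAm.prod .univ) (by rw [hAv]; exact ENNReal.ofReal_ne_top), hAv,
      ENNReal.toReal_ofReal (by positivity), ← ENNReal.ofReal_pow (Real.exp_pos _).le,
      ← Real.exp_nat_mul, mul_neg]
  have hq : 72 * ENNReal.ofReal (Real.exp (-v)) ≤ 2⁻¹ := by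
    -- The renormalisation needs `72 * q ≤ 1/2`, hence `144`; `2.7 ^ 7` exceeds it comfortably.
    have h1 : Real.exp (-v) ≤ 1 / 144 := by
      have h2 : (2.7 : ℝ) ^ 7 ≤ Real.exp 7 := by
        have : Real.exp 7 = Real.exp 1 ^ 7 := by rw [← Real.exp_nat_mul]; norm_num
        rw [this]
        exact pow_le_pow_left₀ (by norm_num) (by linarith [Real.exp_one_gt_d9]) 7
      have h3 : Real.exp 7 ≤ Real.exp v := Real.exp_le_exp.2 hlarge
      rw [Real.exp_neg, inv_eq_one_div]
      exact one_div_le_one_div_of_le (by norm_num) (by linarith [h2, h3, (by norm_num :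
        (144 : ℝ) ≤ 2.7 ^ 7)])
    have e1 : (72 : ℝ≥0∞) = ENNReal.ofReal 72 := by simp
    have e2 : (2⁻¹ : ℝ≥0∞) = ENNReal.ofReal 2⁻¹ := by
      rw [ENNReal.ofReal_inv_of_pos two_pos]; simp
    rw [e1, e2, ← ENNReal.ofReal_mul (by norm_num)]
    exact ENNReal.ofReal_le_ofReal (by linarith)
  filter_upwards [ae_eventually_not_bad hq hB (0, 0), h.ae_orientation_eq] with a ⟨m₀, hm₀⟩ ha
  exact percolates_of_eventually_not_bad hn hL hp ha hm₀

end Supercritical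

end PoissonStick

/-! ### The two bounds on the critical intensity -/

theorem theorem4 (d : ℕ) (hd : 2 ≤ d) :
    (∀ L : ℝ, 3 < L →
      ((Real.Gamma (((d : ℝ) + 1) / 2) / (2 ^ d * Real.pi ^ ((d : ℝ) / 2)) * L⁻¹ : ℝ) : EReal)
        ≤ PoissonStick.rigidCriticalIntensity hd L) ∧
    (∀ L : ℝ, 10 < L →
      PoissonStick.rigidCriticalIntensity hd L ≤
        ((4 * (2 ^ d * Real.Gamma (((d : ℝ) + 1) / 2) / Real.pi ^ ((d : ℝ) / 2 - 1)) * L⁻¹ : ℝ) :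
          EReal)) := by
  obtain ⟨n, rfl⟩ := Nat.exists_eq_add_of_le' (show 1 ≤ d by omega)
  have hn : 0 < n := by omega
  have hΓ : 0 < Real.Gamma ((n : ℝ) / 2 + 1) := Real.Gamma_pos_of_pos (by positivity)
  have hs : 0 < √Real.pi := Real.sqrt_pos.2 Real.pi_pos
  have e1 : (((n + 1 : ℕ) : ℝ) + 1) / 2 = (n : ℝ) / 2 + 1 := by push_cast; ring
  have e2 : Real.pi ^ (((n + 1 : ℕ) : ℝ) / 2) = √Real.pi ^ (n + 1) := by
    rw [Real.sqrt_eq_rpow, ← Real.rpow_natCast, ← Real.rpow_mul Real.pi_pos.le]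
    congr 1
    ring
  have e3 : Real.pi ^ (((n + 1 : ℕ) : ℝ) / 2 - 1) = √Real.pi ^ n / √Real.pi := by
    rw [Real.rpow_sub_one Real.pi_pos.ne', e2, pow_succ, div_eq_div_iff Real.pi_pos.ne' hs.ne',
      mul_assoc, Real.mul_self_sqrt Real.pi_pos.le]
  rw [e1, e2, e3]
  have hp : ((PoissonStick.e₂ hd : PoissonStick.Orientation (n + 1)) :
      EuclideanSpace ℝ (Fin (n + 1))) = EuclideanSpace.single ⟨1, hd⟩ 1 := rfl
  constructor
  · intro L hL
    refine le_sInf ?_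
    rintro _ ⟨lam, hlam, ⟨Ω, _, P, N, hP, hN, hperc⟩, rfl⟩
    rw [EReal.coe_le_coe_iff]
    by_contra hlt
    push Not at hlt
    have hsmall : lam * (2 * (L + 2) * (2 ^ n * PoissonStick.unitBallVolume n)) < 1 := by
      have hpos : 0 < 2 * (L + 2) * (2 ^ n * PoissonStick.unitBallVolume n) :=
        mul_pos (by linarith) (mul_pos (by positivity) (PoissonStick.unitBallVolume_pos n))
      refine (mul_lt_mul_of_pos_right hlt hpos).trans_le ?_
      -- At the claimed bound, intensity times cylinder volume equals `(L + 2) / (√π * L)`. For `L >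
      -- 3` the ratio `(L + 2) / L` is below `5/3`, and `√π ≥ 5/3` because `25/9 < 3`.
      have e : Real.Gamma ((n : ℝ) / 2 + 1) / (2 ^ (n + 1) * √Real.pi ^ (n + 1)) * L⁻¹ *
          (2 * (L + 2) * (2 ^ n * PoissonStick.unitBallVolume n)) = (L + 2) / (√Real.pi * L) := by
        rw [PoissonStick.unitBallVolume]
        field_simp
        ring
      rw [e, div_le_one (by positivity)]
      have h53 : (5 / 3 : ℝ) ≤ √Real.pi :=
        Real.le_sqrt_of_sq_le (by linarith [Real.pi_gt_three])
      nlinarith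
    have hnot := PoissonStick.ae_not_percolates hn hp (by linarith) hlam hsmall hN
    obtain ⟨a, h1, h2⟩ := (hperc.and hnot).exists
    exact h2 h1
  · intro L hL
    refine sInf_le ⟨_, ?_, ?_, rfl⟩
    · positivity
    · obtain ⟨Ω, _, P, N, hP, hN⟩ := PoissonStick.exists_rigid_process (Nat.succ_pos n)
        (PoissonStick.e₂ hd) (4 * (2 ^ (n + 1) * Real.Gamma ((n : ℝ) / 2 + 1) /
          (√Real.pi ^ n / √Real.pi)) * L⁻¹)
      refine ⟨Ω, _, P, N, hP, hN, PoissonStick.ae_percolates hn hp (by linarith) (by positivity)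
        ?_ hN⟩
      -- The mean number of centres per cell is exactly `4 * √π`, which is at least the required 7
      -- since `(7/4)² = 3.0625 < π`.
      have e : 4 * (2 ^ (n + 1) * Real.Gamma ((n : ℝ) / 2 + 1) /
          (√Real.pi ^ n / √Real.pi)) * L⁻¹ *
          (L / 2 * ((1 / 2) ^ n * PoissonStick.unitBallVolume n)) = 4 * √Real.pi := by
        rw [PoissonStick.unitBallVolume, one_div_pow]
        field_simp
        ring
      rw [e]
      have h74 : (7 / 4 : ℝ) ≤ √Real.pi :=
        Real.le_sqrt_of_sq_le (by linarith [Real.pi_gt_d2])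
      linarith
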